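/- Let $d\ge1$ and let $X^{(1)},X^{(2)},\dots$ be i.i.d. random vectors in $\mathbb R^d$ with independent Exponential$(1)$ coordinates. Write $x\prec y$ if $x_j<y_j$ for every $1\le j\le d$. Call $X^{(k)}$ a (Pareto) record if $X^{(k)}\not\prec X^{(i)}$ for all $1\le i<k$; for $1 \le k\le n$ call $X^{(k)}$ a remaining record at time $n$ if $X^{(k)}\not\prec X^{(i)}$ for all $1\le i\le n$, and a broken record at time $n$ if it is a record but not a remaining record at time $n$. Let $R_n$ be the number of records $X^{(k)}$ with $1\le k\le n$, $r_n$ the number of remaining records at time $n$, and $\beta_n=R_n-r_n$ the number of broken records at time $n$. (a) For every $\epsilon>0$, $P\big(|R_n-ER_n|\ge(\ln n)^{3d/4+\epsilon}\text{ for infinitely many }n\big)=0$. As a consequence, $R_n/ER_n\to1$ almost surely. (b) For every $\epsilon>0$, $P\big(|\beta_n-E\beta_n|\ge(\ln n)^{3d/4+\epsilon}\text{ for infinitely many }n\big)=0$. As a consequence, $\beta_n/E\beta_n\to1$ almost surely. (c) For every $\epsilon>0$, $P\big(|r_n-Er_n|\ge(\ln n)^{3d/4+\epsilon}\text{ for infinitely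 many }n\big)=0$. As a consequence, if $d\ge5$, then $r_n/Er_n\to1$ almost surely. -/

import Mathlib

open MeasureTheory ProbabilityTheory Filter Topology

namespace ParetoRecords

/-! Observations are numbered from `0`: for a sequence `x : ℕ → Fin d → ℝ`, the first `n`
observations are `x 0, …, x (n - 1)`.  The relation `StrongLT a b` says that `a j < b j` for
every coordinate `j`. -/

/-- The observation `x k` is a (Pareto) record: it is not dominated by an earlier observation. -/
def IsRecord {d : ℕ} (x : ℕ → Fin d → ℝ) (k : ℕ) : Prop :=
  ∀ i, i < k → ¬ StrongLT (x k) (x i)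

/-- Among the first `n` observations, `x k` (with `k < n`) is a current (remaining) record: it is
not dominated by any of them. -/
def IsCurrentRecord {d : ℕ} (x : ℕ → Fin d → ℝ) (n k : ℕ) : Prop :=
  ∀ i, i < n → ¬ StrongLT (x k) (x i)

/-- Among the first `n` observations, `x k` (with `k < n`) is a broken record: it is a record, but
it is dominated by some later one of them. -/
def IsBrokenRecord {d : ℕ} (x : ℕ → Fin d → ℝ) (n k : ℕ) : Prop :=
  IsRecord x k ∧ ∃ l, k < l ∧ l < n ∧ StrongLT (x k) (x l)

open Classical in
/-- `R_n`: the number of records set by the first `n` observations. -/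
noncomputable def recordCount {d : ℕ} (x : ℕ → Fin d → ℝ) (n : ℕ) : ℕ :=
  ((Finset.range n).filter fun k => IsRecord x k).card

open Classical in
/-- `r_n`: the number of current records among the first `n` observations. -/
noncomputable def currentCount {d : ℕ} (x : ℕ → Fin d → ℝ) (n : ℕ) : ℕ :=
  ((Finset.range n).filter fun k => IsCurrentRecord x n k).card

open Classical in
/-- `β_n`: the number of broken records among the first `n` observations. -/
noncomputable def brokenCount {d : ℕ} (x : ℕ → Fin d → ℝ) (n : ℕ) : ℕ :=
  ((Finset.range n).filter fun k => IsBrokenRecord x n k).card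

/-- `β_n = R_n - r_n`, written without subtraction. -/
theorem currentCount_add_brokenCount {d : ℕ} (hd : 1 ≤ d) (x : ℕ → Fin d → ℝ) (n : ℕ) :
    currentCount x n + brokenCount x n = recordCount x n := by
  classical
  unfold currentCount brokenCount recordCount
  rw [← Finset.card_union_of_disjoint]
  · congr 1
    ext k
    simp only [Finset.mem_union, Finset.mem_filter, Finset.mem_range]
    constructor
    · rintro (⟨hk, h⟩ | ⟨hk, h⟩)
      · exact ⟨hk, fun i hi => h i (hi.trans hk)⟩
      · exact ⟨hk, h.1⟩
    · rintro ⟨hk, h⟩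
      by_cases hb : IsBrokenRecord x n k
      · exact Or.inr ⟨hk, hb⟩
      · refine Or.inl ⟨hk, fun i hi hlt => ?_⟩
        rcases lt_trichotomy i k with hik | hik | hik
        · exact h i hik hlt
        · subst hik
          exact lt_irrefl _ (hlt ⟨0, hd⟩)
        · exact hb ⟨h, i, hik, hi, hlt⟩
  · rw [Finset.disjoint_left]
    intro k h1 h2
    obtain ⟨-, l, -, hl, hlt⟩ := (Finset.mem_filter.mp h2).2
    exact (Finset.mem_filter.mp h1).2 l hl hlt

section Counts

variable {Ω : Type*} {d : ℕ}

/-- The random variable `R_n`. -/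
noncomputable def R (X : ℕ → Ω → Fin d → ℝ) (n : ℕ) (ω : Ω) : ℝ :=
  recordCount (fun k => X k ω) n

/-- The random variable `β_n`. -/
noncomputable def β (X : ℕ → Ω → Fin d → ℝ) (n : ℕ) (ω : Ω) : ℝ :=
  brokenCount (fun k => X k ω) n

/-- The random variable `r_n`. -/
noncomputable def r (X : ℕ → Ω → Fin d → ℝ) (n : ℕ) (ω : Ω) : ℝ :=
  currentCount (fun k => X k ω) n

end Counts

end ParetoRecords

/-! Let p(x) be the probability that a fresh observation dominates x; it is the product of the
exp(-x_l). An observation compared with n others is undominated with probability `recordProb d n`,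
the mean of (1 - p)^n. Integrating out one coordinate gives the recursion `recordProb_succ_left`.
Hence in dimension d + 1 one has E r_n = `recordMean d n` and E R_n = `recordMean (d + 1) n`, and
induction on d puts `recordMean d n` between constant multiples of (ln n)^d for large n.

The probabilistic core is that Var R_n and Var r_n are at most a constant times the corresponding
means. Write M for the probability of dominating both u and w, and q for that of dominating w. The
covariances of the indicators reduce to integrals of M/q times a power of the probability of
dominating neither (`sum_pair_excess_le`, `pair_excess_le`). Because max(u,w) = (u+w)/2 + |u-w|/2,
the ratio M/q splits into square roots of the two tail probabilities and a kernel exp(w - |u-w|/2)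
per coordinate. The exponential law gives each kernel mass at most 4, uniformly in u, and the square
roots are absorbed by the powers (`pairIntegral_le`).

R_n and β_n are nondecreasing in n, their means grow by at most 1 per step and tend to infinity, and
their variances are O(1 + mean). For β this uses E r_n ≤ E R_n / 2 + C. Chebyshev and Borel–Cantelli
along times where the mean is about k^4, with deviations k^3, control a subsequence; monotonicity
fills the gaps, since (k+1)^4 - k^4 = O(k^3). This is `ae_eventually_abs_sub_integral_le`, with
error O(mean^(3/4)), hence O((ln n)^(3d/4)) in dimension d. The count r_n is not monotone, so its
bound comes from r = R - β. Compared with E r_n of order (ln n)^(d-1), this error is negligible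
exactly when d - 1 > 3d/4, that is d ≥ 5. -/

namespace ParetoRecords

/-! ### The exponential law and one-dimensional integrals -/

section

open scoped ENNReal

/-- The law of a vector with independent standard exponential coordinates. -/
noncomputable abbrev expLaw (d : ℕ) : Measure (Fin d → ℝ) :=
  Measure.pi fun _ : Fin d => expMeasure 1

instance : IsProbabilityMeasure (expMeasure 1) := isProbabilityMeasure_expMeasure one_pos

theorem expMeasure_one_eq_withDensity :
    expMeasure 1 =
      (volume.restrict (Set.Ioi 0)).withDensity fun x => ENNReal.ofReal (Real.exp (-x)) := by
  rw [← withDensity_indicator measurableSet_Ioi]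
  change volume.withDensity (exponentialPDF 1) = _
  refine withDensity_congr_ae ?_
  filter_upwards [Measure.ae_ne volume (0 : ℝ)] with x hx
  rcases lt_or_gt_of_ne hx with h | h
  · rw [exponentialPDF_of_neg h, Set.indicator_of_notMem (by simpa using h.le)]
  · rw [exponentialPDF_of_nonneg h.le, Set.indicator_of_mem (by simpa using h)]
    simp

theorem lintegral_expMeasure_one (f : ℝ → ℝ≥0∞) (hf : Measurable f) :
    ∫⁻ x, f x ∂expMeasure 1 = ∫⁻ x in Set.Ioi 0, ENNReal.ofReal (Real.exp (-x)) * f x := by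
  rw [expMeasure_one_eq_withDensity,
    lintegral_withDensity_eq_lintegral_mul _ (by fun_prop) hf]
  rfl

theorem integral_expMeasure_one (f : ℝ → ℝ) :
    ∫ x, f x ∂expMeasure 1 = ∫ x in Set.Ioi 0, Real.exp (-x) * f x := by
  rw [expMeasure_one_eq_withDensity, integral_withDensity_eq_integral_toReal_smul (by fun_prop)
    (by simp)]
  simp [ENNReal.toReal_ofReal, Real.exp_nonneg]

theorem expMeasure_one_real_Ioi {t : ℝ} (ht : 0 ≤ t) :
    (expMeasure 1).real (Set.Ioi t) = Real.exp (-t) := by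
  have h := cdf_expMeasure_eq one_pos t
  rw [if_pos ht, cdf_eq_real, one_mul] at h
  rw [← Set.compl_Iic, probReal_compl_eq_one_sub measurableSet_Iic, h]
  ring

theorem ae_expMeasure_one_nonneg : ∀ᵐ x ∂expMeasure 1, 0 ≤ x := by
  rw [expMeasure_one_eq_withDensity]
  refine (withDensity_absolutelyContinuous _ _).ae_le ?_
  filter_upwards [ae_restrict_mem measurableSet_Ioi] with x hx using le_of_lt hx

theorem ae_expLaw_nonneg (d : ℕ) : ∀ᵐ x ∂expLaw d, ∀ l, 0 ≤ x l := by
  rw [ae_all_iff]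
  intro l
  exact (Measure.quasiMeasurePreserving_eval (fun _ : Fin d => expMeasure 1) l).ae
    ae_expMeasure_one_nonneg

/-- The integrand times the density has antiderivative (1 - c e^{-x})^(n+1) / ((n+1)c). The boundary
values leave (1 - (1-c)^(n+1))/c, a geometric sum. This drives the recursion in the dimension. -/
theorem integral_one_sub_mul_exp_pow {c : ℝ} (hc : 0 < c) (hc1 : c ≤ 1) (n : ℕ) :
    (n + 1) * ∫ x, (1 - c * Real.exp (-x)) ^ n ∂expMeasure 1 =
      ∑ j ∈ Finset.range (n + 1), (1 - c) ^ j := by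
  rw [integral_expMeasure_one]
  have hn : (n + 1 : ℝ) ≠ 0 := by positivity
  have hderiv : ∀ x ∈ Set.Ici (0 : ℝ), HasDerivAt
      (fun x => (1 - c * Real.exp (-x)) ^ (n + 1) / ((n + 1) * c))
      (Real.exp (-x) * (1 - c * Real.exp (-x)) ^ n) x := by
    intro x _
    have h1 : HasDerivAt (fun x => 1 - c * Real.exp (-x)) (c * Real.exp (-x)) x := by
      have := (((hasDerivAt_id x).neg.exp).const_mul c).const_sub 1
      simpa using this
    have h2 := (h1.pow (n + 1)).div_const ((n + 1) * c)
    convert! h2 using 1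
    push_cast
    field_simp
  have hlim : Tendsto (fun x : ℝ => (1 - c * Real.exp (-x)) ^ (n + 1) / ((n + 1) * c)) atTop
      (𝓝 ((1 - c * 0) ^ (n + 1) / ((n + 1) * c))) :=
    (((Real.tendsto_exp_neg_atTop_nhds_zero.const_mul c).const_sub 1).pow _).div_const _
  have hpos : ∀ x ∈ Set.Ioi (0 : ℝ), 0 ≤ Real.exp (-x) * (1 - c * Real.exp (-x)) ^ n := by
    intro x hx
    have : Real.exp (-x) ≤ 1 := by simpa using le_of_lt hx
    have : c * Real.exp (-x) ≤ 1 := by nlinarith [Real.exp_pos (-x)]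
    have : 0 ≤ 1 - c * Real.exp (-x) := by linarith
    positivity
  rw [integral_Ioi_of_hasDerivAt_of_nonneg' hderiv hpos hlim]
  have hg := mul_neg_geom_sum (1 - c) (n + 1)
  rw [sub_sub_cancel] at hg
  simp only [mul_zero, sub_zero, one_pow, neg_zero, Real.exp_zero, mul_one]
  field_simp
  rw [hg]

/-- The factor e^y cancels the exponential density, leaving exp(-|x-y|/2), which has mass 2 on each
side of x. Uniformity in x is what matters later. -/
theorem lintegral_exp_neg_half_abs_sub_le (x : ℝ) :
    ∫⁻ y, ENNReal.ofReal (Real.exp (y - |x - y| / 2)) ∂expMeasure 1 ≤ 4 := by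
  rw [lintegral_expMeasure_one _ (by fun_prop)]
  calc ∫⁻ y in Set.Ioi 0, ENNReal.ofReal (Real.exp (-y)) *
        ENNReal.ofReal (Real.exp (y - |x - y| / 2))
      = ∫⁻ y in Set.Ioi 0, ENNReal.ofReal (Real.exp (-(|x - y| / 2))) := by
        congr 1 with y
        rw [← ENNReal.ofReal_mul (Real.exp_nonneg _), ← Real.exp_add]
        congr 2
        ring
    _ ≤ ∫⁻ y, ENNReal.ofReal (Real.exp (-(|x - y| / 2))) := setLIntegral_le_lintegral _ _
    _ = (∫⁻ y in Set.Iic x, ENNReal.ofReal (Real.exp (-(|x - y| / 2)))) +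
          ∫⁻ y in Set.Ioi x, ENNReal.ofReal (Real.exp (-(|x - y| / 2))) := by
        rw [← lintegral_add_compl _ (measurableSet_Iic (a := x)), Set.compl_Iic]
    _ = (∫⁻ y in Set.Iic x, ENNReal.ofReal (Real.exp (-(x / 2)) * Real.exp (1 / 2 * y))) +
          ∫⁻ y in Set.Ioi x, ENNReal.ofReal (Real.exp (x / 2) * Real.exp (-(1 / 2) * y)) := by
        congr 1
        · refine setLIntegral_congr_fun measurableSet_Iic fun y hy => ?_
          simp only [Set.mem_Iic] at hy
          rw [← Real.exp_add, abs_of_nonneg (by linarith)]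
          congr 2
          ring
        · refine setLIntegral_congr_fun measurableSet_Ioi fun y hy => ?_
          simp only [Set.mem_Ioi] at hy
          rw [← Real.exp_add, abs_of_neg (by linarith)]
          congr 2
          ring
    _ = 2 + 2 := by
        congr 1
        · rw [← ofReal_integral_eq_lintegral_ofReal
            ((integrableOn_exp_mul_Iic (by norm_num) x).const_mul _)
            (ae_of_all _ fun y => by positivity), integral_const_mul,
            integral_exp_mul_Iic (by norm_num)]
          rw [mul_div_assoc', ← Real.exp_add]
          ring_nf
          norm_num
        · rw [← ofReal_integral_eq_lintegral_ofReal
            ((integrableOn_exp_mul_Ioi (by norm_num) x).const_mul _)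
            (ae_of_all _ fun y => by positivity), integral_const_mul,
            integral_exp_mul_Ioi (by norm_num)]
          rw [mul_div_assoc', mul_neg, ← Real.exp_add]
          ring_nf
          norm_num
    _ = 4 := by norm_num

theorem lintegral_fin_prod_eq_prod {d : ℕ} (ν : Measure ℝ) [SigmaFinite ν]
    (f : Fin d → ℝ → ℝ≥0∞) (hf : ∀ i, Measurable (f i)) :
    ∫⁻ x : Fin d → ℝ, ∏ i, f i (x i) ∂(Measure.pi fun _ => ν) = ∏ i, ∫⁻ y, f i y ∂ν := by
  induction d with
  | zero => simp
  | succ n ih =>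
    rw [← ((measurePreserving_piFinSuccAbove (fun _ : Fin (n + 1) => ν) 0).symm).lintegral_comp_emb
      (MeasurableEquiv.measurableEmbedding _)]
    simp_rw [MeasurableEquiv.piFinSuccAbove_symm_apply, Fin.insertNthEquiv,
      Fin.prod_univ_succ, Fin.insertNth_zero, Equiv.coe_fn_mk, Fin.cons_succ, Fin.cons_zero]
    rw [← ih _ fun i : Fin n => hf i.succ]
    exact lintegral_prod_mul (hf 0).aemeasurable
      (Finset.measurable_fun_prod _ fun (i : Fin n) _ =>
        (hf i.succ).comp (measurable_pi_apply i)).aemeasurable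

end

/-! ### Tail probabilities and the record probability -/

section

/-- The probability that an observation dominates `x`. -/
noncomputable def tailProb {d : ℕ} (x : Fin d → ℝ) : ℝ :=
  (expLaw d).real {z | StrongLT x z}

/-- The probability that an observation dominates both `u` and `w`. -/
noncomputable def jointTail {d : ℕ} (u w : Fin d → ℝ) : ℝ :=
  (expLaw d).real {z | StrongLT u z ∧ StrongLT w z}

/-- The probability that an observation dominates neither `u` nor `w`. -/
noncomputable def missProb {d : ℕ} (u w : Fin d → ℝ) : ℝ :=
  (expLaw d).real {z | ¬ StrongLT u z ∧ ¬ StrongLT w z}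

/-- The probability that an observation is not dominated by `n` other ones. -/
noncomputable def recordProb (d n : ℕ) : ℝ :=
  ∫ x, (1 - tailProb x) ^ n ∂expLaw d

variable {d : ℕ}

theorem measurableSet_strongLT_prod :
    MeasurableSet {q : (Fin d → ℝ) × (Fin d → ℝ) | StrongLT q.1 q.2} := by
  simp only [StrongLT, Set.ofPred_forall]
  exact MeasurableSet.iInter fun l => measurableSet_lt (by fun_prop) (by fun_prop)

theorem measurableSet_strongLT {α : Type*} [MeasurableSpace α] {f g : α → Fin d → ℝ}
    (hf : Measurable f) (hg : Measurable g) : MeasurableSet {a | StrongLT (f a) (g a)} :=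
  (hf.prodMk hg) measurableSet_strongLT_prod

@[fun_prop]
theorem measurable_tailProb : Measurable (tailProb : (Fin d → ℝ) → ℝ) :=
  (measurable_measure_prodMk_left (ν := expLaw d) measurableSet_strongLT_prod).ennreal_toReal

theorem measurable_jointTail :
    Measurable fun q : (Fin d → ℝ) × (Fin d → ℝ) => jointTail q.1 q.2 := by
  refine (measurable_measure_prodMk_left (ν := expLaw d)
    (s := {t : ((Fin d → ℝ) × (Fin d → ℝ)) × (Fin d → ℝ) |
      StrongLT t.1.1 t.2 ∧ StrongLT t.1.2 t.2}) ?_).ennreal_toReal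
  exact (measurableSet_strongLT (by fun_prop) (by fun_prop)).inter
    (measurableSet_strongLT (by fun_prop) (by fun_prop))

theorem measurable_missProb :
    Measurable fun q : (Fin d → ℝ) × (Fin d → ℝ) => missProb q.1 q.2 := by
  refine (measurable_measure_prodMk_left (ν := expLaw d)
    (s := {t : ((Fin d → ℝ) × (Fin d → ℝ)) × (Fin d → ℝ) |
      ¬ StrongLT t.1.1 t.2 ∧ ¬ StrongLT t.1.2 t.2}) ?_).ennreal_toReal
  exact (measurableSet_strongLT (by fun_prop) (by fun_prop)).compl.inter
    (measurableSet_strongLT (by fun_prop) (by fun_prop)).compl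

theorem tailProb_nonneg (x : Fin d → ℝ) : 0 ≤ tailProb x := measureReal_nonneg

theorem tailProb_le_one (x : Fin d → ℝ) : tailProb x ≤ 1 := measureReal_le_one

theorem jointTail_nonneg (u w : Fin d → ℝ) : 0 ≤ jointTail u w := measureReal_nonneg

theorem jointTail_le_right (u w : Fin d → ℝ) : jointTail u w ≤ tailProb w :=
  measureReal_mono fun _ h => h.2

theorem missProb_nonneg (u w : Fin d → ℝ) : 0 ≤ missProb u w := measureReal_nonneg

theorem missProb_le_one (u w : Fin d → ℝ) : missProb u w ≤ 1 := measureReal_le_one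

theorem one_sub_tailProb (x : Fin d → ℝ) :
    (expLaw d).real {z | ¬ StrongLT x z} = 1 - tailProb x :=
  probReal_compl_eq_one_sub (measurableSet_strongLT measurable_const measurable_id)

theorem missProb_le_left (u w : Fin d → ℝ) : missProb u w ≤ 1 - tailProb u := by
  rw [← one_sub_tailProb]
  exact measureReal_mono fun _ h => h.1

theorem missProb_le_right (u w : Fin d → ℝ) : missProb u w ≤ 1 - tailProb w := by
  rw [← one_sub_tailProb]
  exact measureReal_mono fun _ h => h.2

theorem missProb_eq (u w : Fin d → ℝ) :
    missProb u w = 1 - tailProb u - tailProb w + jointTail u w := by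
  have h1 : MeasurableSet {z | StrongLT u z} := measurableSet_strongLT measurable_const measurable_id
  have h2 : MeasurableSet {z | StrongLT w z} := measurableSet_strongLT measurable_const measurable_id
  have h := measureReal_union_add_inter (μ := expLaw d) (s := {z | StrongLT u z}) h2
  have h3 := probReal_compl_eq_one_sub (μ := expLaw d) (h1.union h2)
  rw [Set.compl_union] at h3
  change missProb u w = _ at h3
  change _ + jointTail u w = tailProb u + tailProb w at h
  linarith

theorem tailProb_eq_prod {x : Fin d → ℝ} (hx : ∀ l, 0 ≤ x l) :
    tailProb x = ∏ l, Real.exp (-x l) := by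
  have : {z | StrongLT x z} = Set.univ.pi fun l => Set.Ioi (x l) := by
    ext z
    simp [StrongLT]
  rw [tailProb, this, measureReal_def, Measure.pi_pi, ENNReal.toReal_prod]
  exact Finset.prod_congr rfl fun l _ => expMeasure_one_real_Ioi (hx l)

theorem jointTail_eq_prod {u w : Fin d → ℝ} (hu : ∀ l, 0 ≤ u l) :
    jointTail u w = ∏ l, Real.exp (-max (u l) (w l)) := by
  have : {z | StrongLT u z ∧ StrongLT w z} = {z | StrongLT (fun l => max (u l) (w l)) z} := by
    ext z
    simp [StrongLT, forall_and]
  rw [jointTail, this]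
  exact tailProb_eq_prod fun l => (hu l).trans (le_max_left _ _)

theorem integrable_one_sub_tailProb_pow (n : ℕ) :
    Integrable (fun x : Fin d → ℝ => (1 - tailProb x) ^ n) (expLaw d) := by
  refine Integrable.of_bound (by fun_prop) 1 (ae_of_all _ fun x => ?_)
  have h0 : 0 ≤ 1 - tailProb x := by linarith [tailProb_le_one x]
  rw [Real.norm_of_nonneg (by positivity)]
  exact pow_le_one₀ h0 (by linarith [tailProb_nonneg x])

theorem recordProb_nonneg (d n : ℕ) : 0 ≤ recordProb d n :=
  integral_nonneg fun x => pow_nonneg (by linarith [tailProb_le_one x]) n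

theorem recordProb_le_one (d n : ℕ) : recordProb d n ≤ 1 := by
  calc recordProb d n ≤ ∫ _, (1 : ℝ) ∂expLaw d :=
        integral_mono (integrable_one_sub_tailProb_pow n) (integrable_const _) fun x =>
          pow_le_one₀ (by linarith [tailProb_le_one x]) (by linarith [tailProb_nonneg x])
    _ = 1 := by simp

/-- In dimension 0 domination is vacuously true, so only an observation compared with nothing is
undominated. This is the base case for inductions on the dimension. -/
theorem recordProb_zero_left (n : ℕ) : recordProb 0 n = 0 ^ n := by
  have h (x : Fin 0 → ℝ) : tailProb x = 1 := by
    simp [tailProb_eq_prod (x := x) (fun l => l.elim0)]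
  simp [recordProb, h]

/-- Fix all coordinates but the first: the tail probability becomes c e^{-x}, with c the tail
probability of the remaining d coordinates. Then `integral_one_sub_mul_exp_pow` applies under the
outer integral. -/
theorem recordProb_succ_left (d n : ℕ) :
    (n + 1) * recordProb (d + 1) n = ∑ j ∈ Finset.range (n + 1), recordProb d j := by
  have hae : (fun x : Fin (d + 1) → ℝ => (1 - tailProb x) ^ n) =ᵐ[expLaw (d + 1)]
      fun x => (1 - ∏ l, Real.exp (-x l)) ^ n := by
    filter_upwards [ae_expLaw_nonneg (d + 1)] with x hx
    rw [tailProb_eq_prod hx]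
  have hint := (integrable_one_sub_tailProb_pow (d := d + 1) n).congr hae
  have hmp := (measurePreserving_piFinSuccAbove (fun _ : Fin (d + 1) => expMeasure 1) 0).symm
  have hint' := (hmp.integrable_comp_emb (MeasurableEquiv.measurableEmbedding _)).2 hint
  have hform (t : ℝ × (Fin d → ℝ)) :
      (1 - ∏ l, Real.exp (-((MeasurableEquiv.piFinSuccAbove (fun _ : Fin (d + 1) => ℝ) 0).symm t) l))
        ^ n = (1 - (∏ l, Real.exp (-t.2 l)) * Real.exp (-t.1)) ^ n := by
    rw [MeasurableEquiv.piFinSuccAbove_symm_apply, Fin.prod_univ_succ]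
    simp [Fin.insertNthEquiv, mul_comm]
  have hcomp : (fun x : Fin (d + 1) → ℝ => (1 - ∏ l, Real.exp (-x l)) ^ n) ∘
      (MeasurableEquiv.piFinSuccAbove (fun _ : Fin (d + 1) => ℝ) 0).symm =
      fun t => (1 - (∏ l, Real.exp (-t.2 l)) * Real.exp (-t.1)) ^ n := funext hform
  rw [hcomp] at hint'
  rw [recordProb, integral_congr_ae hae, ← hmp.integral_comp']
  simp_rw [hform]
  rw [integral_prod_symm _ hint', ← integral_const_mul]
  simp_rw [recordProb]
  rw [← integral_finsetSum _ fun j _ => integrable_one_sub_tailProb_pow j]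
  refine integral_congr_ae ?_
  filter_upwards [ae_expLaw_nonneg d] with y hy
  rw [tailProb_eq_prod hy]
  refine integral_one_sub_mul_exp_pow (Finset.prod_pos fun l _ => Real.exp_pos _) ?_ n
  exact Finset.prod_le_one (fun l _ => (Real.exp_pos _).le) fun l _ => by simpa using hy l

end

/-! ### Logarithmic growth of the means -/

section

/-- The expected number of records among the first `n` observations in dimension `d`; it is also
the expected number of current records at time `n` in dimension `d + 1`. -/
noncomputable def recordMean (d n : ℕ) : ℝ :=
  ∑ k ∈ Finset.range n, recordProb d k

theorem succ_mul_recordProb (d n : ℕ) :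
    (n + 1) * recordProb (d + 1) n = recordMean d (n + 1) :=
  recordProb_succ_left d n

theorem recordMean_mono (d : ℕ) : Monotone (recordMean d) := fun _ _ h =>
  Finset.sum_le_sum_of_subset_of_nonneg (Finset.range_mono h) fun _ _ _ => recordProb_nonneg _ _

theorem recordMean_nonneg (d n : ℕ) : 0 ≤ recordMean d n :=
  Finset.sum_nonneg fun _ _ => recordProb_nonneg _ _

theorem recordMean_zero_left (n : ℕ) : recordMean 0 (n + 1) = 1 := by
  simp [recordMean, recordProb_zero_left, Finset.sum_range_succ']

theorem recordMean_succ_left (d n : ℕ) :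
    recordMean (d + 1) n = ∑ j ∈ Finset.range n, recordMean d (j + 1) / (j + 1) := by
  refine Finset.sum_congr rfl fun j _ => ?_
  rw [← succ_mul_recordProb]
  field_simp

/-- Each step in d divides by j + 1 and sums. Bounding the numerator by its last value leaves a
harmonic sum, which costs one more factor 1 + log. -/
theorem recordMean_le (d n : ℕ) : recordMean d (n + 1) ≤ (1 + Real.log (n + 1)) ^ d := by
  induction d generalizing n with
  | zero => simp [recordMean_zero_left]
  | succ d ih =>
    rw [recordMean_succ_left]
    have hlog : 0 ≤ Real.log (n + 1) := Real.log_nonneg (by linarith [n.cast_nonneg (α := ℝ)])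
    calc ∑ j ∈ Finset.range (n + 1), recordMean d (j + 1) / (j + 1)
        ≤ ∑ j ∈ Finset.range (n + 1), (1 + Real.log (n + 1)) ^ d * ((j : ℝ) + 1)⁻¹ := by
          refine Finset.sum_le_sum fun j hj => ?_
          rw [div_eq_mul_inv]
          gcongr
          calc recordMean d (j + 1) ≤ recordMean d (n + 1) :=
                recordMean_mono d (Finset.mem_range.1 hj)
            _ ≤ _ := ih n
      _ = (1 + Real.log (n + 1)) ^ d * (harmonic (n + 1) : ℝ) := by
          rw [← Finset.mul_sum, harmonic]
          push_cast
          rfl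
      _ ≤ (1 + Real.log (n + 1)) ^ d * (1 + Real.log (n + 1)) := by
          gcongr
          simpa using harmonic_le_one_add_log (n + 1)
      _ = _ := (pow_succ _ _).symm

/-- The increments of log^(d+1)/(d+1)! are at most log^d/d! times 1/(j+1), so the recursion
dominates a telescoping sum. -/
theorem le_recordMean (d n : ℕ) :
    Real.log (n + 2) ^ d / d.factorial ≤ recordMean d (n + 1) := by
  induction d generalizing n with
  | zero => simp [recordMean_zero_left]
  | succ d ih =>
    have hstep (j : ℕ) : (Real.log (j + 2) ^ (d + 1) - Real.log (j + 1) ^ (d + 1)) /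
        (d + 1).factorial ≤ recordMean d (j + 1) / (j + 1) := by
      have hj : (0 : ℝ) < j + 1 := by positivity
      have h0 : 0 ≤ Real.log (j + 1) := Real.log_nonneg (by linarith [j.cast_nonneg (α := ℝ)])
      have h1 : Real.log (j + 1) ≤ Real.log (j + 2) := Real.log_le_log hj (by linarith)
      have h2 : Real.log (j + 2) - Real.log (j + 1) ≤ 1 / (j + 1) := by
        rw [← Real.log_div (by positivity) (by positivity)]
        refine (Real.log_le_sub_one_of_pos (by positivity)).trans (le_of_eq ?_)
        field_simp
        ring
      have h3 : Real.log (j + 2) ^ (d + 1) - Real.log (j + 1) ^ (d + 1) ≤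
          (d + 1) * Real.log (j + 2) ^ d * (1 / (j + 1)) := by
        calc Real.log (j + 2) ^ (d + 1) - Real.log (j + 1) ^ (d + 1)
            = (∑ i ∈ Finset.range (d + 1), Real.log (j + 2) ^ i * Real.log (j + 1) ^ (d - i)) *
                (Real.log (j + 2) - Real.log (j + 1)) := by
              rw [← (Commute.all _ _).geom_sum₂_mul]
              simp
          _ ≤ (∑ i ∈ Finset.range (d + 1), Real.log (j + 2) ^ d) * (1 / (j + 1)) := by
              have hs : ∀ i ∈ Finset.range (d + 1),
                  Real.log (j + 2) ^ i * Real.log (j + 1) ^ (d - i) ≤ Real.log (j + 2) ^ d := by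
                intro i hi
                rw [← pow_mul_pow_sub _ (Nat.lt_succ_iff.1 (Finset.mem_range.1 hi))]
                have := h0.trans h1
                gcongr
              refine mul_le_mul (Finset.sum_le_sum hs) h2 (by linarith) ?_
              exact Finset.sum_nonneg fun _ _ => pow_nonneg (h0.trans h1) _
          _ = _ := by simp
      calc _ ≤ (d + 1) * Real.log (j + 2) ^ d * (1 / (j + 1)) / (d + 1).factorial := by gcongr
        _ = (Real.log (j + 2) ^ d / d.factorial) / (j + 1) := by
            rw [Nat.factorial_succ]
            push_cast
            field_simp
        _ ≤ _ := by
            gcongr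
            exact ih j
    rw [recordMean_succ_left]
    refine le_trans (le_of_eq ?_) (Finset.sum_le_sum fun j _ => hstep j)
    rw [← Finset.sum_div]
    congr 1
    have := Finset.sum_range_sub (fun j : ℕ => Real.log (j + 1) ^ (d + 1)) (n + 1)
    simp only [Nat.cast_add, Nat.cast_one, add_assoc, one_add_one_eq_two] at this
    simp [this]

/-- A power of the logarithm is negligible against the next one. In probabilistic terms E r_n ≤ E
R_n / 2 + C, so E β_n is comparable to E R_n. -/
theorem exists_recordMean_le_half (d : ℕ) :
    ∃ C : ℝ, ∀ n, recordMean d n ≤ recordMean (d + 1) n / 2 + C := by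
  -- The threshold for t = log(n+2): if t > A then (1+t)^d ≤ (2t)^d ≤ t^(d+1) / (2 (d+1)!). Below it
  -- the mean is bounded by (1+A)^d.
  set A : ℝ := 2 ^ (d + 1) * (d + 1).factorial with hA
  have hA1 : 1 ≤ A := one_le_mul_of_one_le_of_one_le (one_le_pow₀ (by norm_num))
    (by exact_mod_cast Nat.succ_le_of_lt (Nat.factorial_pos _))
  refine ⟨(1 + A) ^ d, fun n => ?_⟩
  have hC : 0 ≤ (1 + A) ^ d := by positivity
  rcases n with _ | n
  · simpa [recordMean] using hC
  have hn : (0 : ℝ) ≤ n := n.cast_nonneg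
  have hu := recordMean_le d n
  have hl := le_recordMean (d + 1) n
  have hlog : 0 ≤ Real.log (n + 1) := Real.log_nonneg (by linarith)
  have hlog2 : Real.log (n + 1) ≤ Real.log (n + 2) := Real.log_le_log (by linarith) (by linarith)
  set t := Real.log (n + 2)
  have ht0 : 0 ≤ t := hlog.trans hlog2
  have hu' : recordMean d (n + 1) ≤ (1 + t) ^ d := hu.trans (by gcongr)
  by_cases ht : t ≤ A
  · have : (1 + t) ^ d ≤ (1 + A) ^ d := by gcongr
    linarith [recordMean_nonneg (d + 1) (n + 1)]
  · push Not at ht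
    have h1 : (1 + t) ^ d ≤ (2 * t) ^ d := by
      gcongr
      linarith
    have h2 : (2 * t) ^ d * A ≤ 2 ^ d * t ^ (d + 1) := by
      rw [mul_pow, pow_succ, mul_assoc]
      gcongr
    have hf : (0 : ℝ) < (d + 1).factorial := by exact_mod_cast Nat.factorial_pos _
    have h3 : (2 * t) ^ d ≤ t ^ (d + 1) / (d + 1).factorial / 2 := by
      rw [le_div_iff₀ two_pos, le_div_iff₀ hf]
      have h4 : (2 : ℝ) ^ d * ((2 * t) ^ d * 2 * (d + 1).factorial) ≤ 2 ^ d * t ^ (d + 1) := by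
        refine le_trans (le_of_eq ?_) h2
        rw [hA]
        ring
      exact le_of_mul_le_mul_left h4 (by positivity)
    linarith

theorem tendsto_recordMean_succ (d : ℕ) : Tendsto (recordMean (d + 1)) atTop atTop := by
  rw [← tendsto_add_atTop_iff_nat 1]
  refine tendsto_atTop_mono (le_recordMean (d + 1)) ?_
  refine Tendsto.atTop_div_const (by exact_mod_cast Nat.factorial_pos _) ?_
  refine (tendsto_pow_atTop (Nat.succ_ne_zero d)).comp (Real.tendsto_log_atTop.comp ?_)
  exact tendsto_atTop_add_const_right _ _ tendsto_natCast_atTop_atTop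

theorem sum_div_four_le {f : ℕ → ℝ} (hf : ∀ k, 0 ≤ f k) (n : ℕ) :
    ∑ i ∈ Finset.range n, f (i / 4) ≤ 4 * ∑ k ∈ Finset.range n, f k := by
  have h (n : ℕ) : ∑ i ∈ Finset.range (4 * n), f (i / 4) = 4 * ∑ k ∈ Finset.range n, f k := by
    induction n with
    | zero => simp
    | succ n ih =>
      rw [mul_add_one, Finset.sum_range_add, ih, Finset.sum_range_succ (n := n), mul_add]
      congr 1
      have : ∀ x ∈ Finset.range 4, f ((4 * n + x) / 4) = f n := fun x hx => by
        rw [Finset.mem_range] at hx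
        congr 1
        omega
      rw [Finset.sum_congr rfl this]
      simp
  rw [← h]
  exact Finset.sum_le_sum_of_subset_of_nonneg (Finset.range_mono (by omega)) fun _ _ _ => hf _

end

/-! ### The pair integral -/

section

open scoped ENNReal

/-- Since x ≤ 1, (k+1)x ≤ 1 + kx ≤ (1+x)^k by Bernoulli, and (1+x)(1-x) ≤ 1. -/
theorem succ_mul_mul_one_sub_pow_le {x : ℝ} (h0 : 0 ≤ x) (h1 : x ≤ 1) (k : ℕ) :
    (k + 1) * (x * (1 - x) ^ k) ≤ 1 := by
  have hb : 1 + k * x ≤ (1 + x) ^ k := one_add_mul_le_pow (by linarith) k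
  have hp : 0 ≤ (1 - x) ^ k := pow_nonneg (by linarith) k
  calc (k + 1) * (x * (1 - x) ^ k) ≤ (1 + k * x) * (1 - x) ^ k := by nlinarith
    _ ≤ (1 + x) ^ k * (1 - x) ^ k := by gcongr
    _ = (1 - x ^ 2) ^ k := by rw [← mul_pow]; ring
    _ ≤ 1 := pow_le_one₀ (by nlinarith) (by nlinarith)

theorem mul_one_sub_sq_pow_le {s : ℝ} (h0 : 0 ≤ s) (h1 : s ≤ 1) (m : ℕ) :
    s * (1 - s ^ 2) ^ m ≤ 1 / √(2 * m + 1) := by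
  have h := succ_mul_mul_one_sub_pow_le (x := s ^ 2) (by positivity) (pow_le_one₀ h0 h1) (2 * m)
  have hp : 0 ≤ 1 - s ^ 2 := by nlinarith
  rw [le_div_iff₀ (by positivity)]
  refine le_of_sq_le_sq ?_ zero_le_one
  rw [mul_pow, Real.sq_sqrt (by positivity), mul_pow, ← pow_mul, one_pow, mul_comm m 2]
  push_cast at h
  linarith

/-- The conditional probability that an observation dominating the second of two independent points
also dominates the first one, averaged over the event that `N` observations dominate neither. -/
noncomputable def pairIntegral (d N : ℕ) : ℝ :=
  ∫ q : (Fin d → ℝ) × (Fin d → ℝ), jointTail q.1 q.2 / tailProb q.2 * missProb q.1 q.2 ^ N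
    ∂(expLaw d).prod (expLaw d)

variable {d : ℕ}

theorem measurable_pairIntegrand (N : ℕ) : Measurable fun q : (Fin d → ℝ) × (Fin d → ℝ) =>
    jointTail q.1 q.2 / tailProb q.2 * missProb q.1 q.2 ^ N :=
  (measurable_jointTail.div (measurable_tailProb.comp measurable_snd)).mul
    (measurable_missProb.pow_const N)

theorem pairIntegrand_nonneg (N : ℕ) (u w : Fin d → ℝ) :
    0 ≤ jointTail u w / tailProb w * missProb u w ^ N :=
  mul_nonneg (div_nonneg (jointTail_nonneg _ _) (tailProb_nonneg _))
    (pow_nonneg (missProb_nonneg _ _) _)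

theorem pairIntegrand_le_one (N : ℕ) (u w : Fin d → ℝ) :
    jointTail u w / tailProb w * missProb u w ^ N ≤ 1 :=
  mul_le_one₀ (div_le_one_of_le₀ (jointTail_le_right _ _) (tailProb_nonneg _))
    (pow_nonneg (missProb_nonneg _ _) _) (pow_le_one₀ (missProb_nonneg _ _) (missProb_le_one _ _))

theorem integrable_pairIntegrand (N : ℕ) : Integrable (fun q : (Fin d → ℝ) × (Fin d → ℝ) =>
    jointTail q.1 q.2 / tailProb q.2 * missProb q.1 q.2 ^ N) ((expLaw d).prod (expLaw d)) := by
  refine Integrable.of_bound (measurable_pairIntegrand N).aestronglyMeasurable 1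
    (ae_of_all _ fun q => ?_)
  rw [Real.norm_of_nonneg (pairIntegrand_nonneg N _ _)]
  exact pairIntegrand_le_one N _ _

theorem pairIntegral_nonneg (d N : ℕ) : 0 ≤ pairIntegral d N :=
  integral_nonneg fun q => pairIntegrand_nonneg N q.1 q.2

/-- With s² and t² the tail probabilities of u and w, the identity max(a,b) = (a+b)/2 + |a-b|/2
makes the joint tail equal to W s t³, so its ratio to t² is W s t. Powers of 1 - s² and 1 - t² then
absorb s and t, each giving a factor (2m+1)^(-1/2). -/
theorem pairIntegrand_le {m N : ℕ} (h : 4 * m ≤ N) {u w : Fin d → ℝ} (hu : ∀ l, 0 ≤ u l)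
    (hw : ∀ l, 0 ≤ w l) :
    jointTail u w / tailProb w * missProb u w ^ N ≤
      (1 - tailProb u) ^ m / (2 * m + 1) * ∏ l, Real.exp (w l - |u l - w l| / 2) := by
  set s := ∏ l, Real.exp (-u l / 2)
  set t := ∏ l, Real.exp (-w l / 2)
  set W := ∏ l, Real.exp (w l - |u l - w l| / 2)
  have hs0 : 0 ≤ s := Finset.prod_nonneg fun l _ => (Real.exp_pos _).le
  have ht0 : 0 < t := Finset.prod_pos fun l _ => Real.exp_pos _
  have hW0 : 0 ≤ W := Finset.prod_nonneg fun l _ => (Real.exp_pos _).le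
  have hs1 : s ≤ 1 := Finset.prod_le_one (fun l _ => (Real.exp_pos _).le) fun l _ =>
    Real.exp_le_one_iff.2 (by linarith [hu l])
  have ht1 : t ≤ 1 := Finset.prod_le_one (fun l _ => (Real.exp_pos _).le) fun l _ =>
    Real.exp_le_one_iff.2 (by linarith [hw l])
  have hp : tailProb u = s ^ 2 := by
    rw [tailProb_eq_prod hu, ← Finset.prod_pow]
    refine Finset.prod_congr rfl fun l _ => ?_
    rw [← Real.exp_nat_mul]
    congr 1
    push_cast
    ring
  have hq : tailProb w = t ^ 2 := by
    rw [tailProb_eq_prod hw, ← Finset.prod_pow]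
    refine Finset.prod_congr rfl fun l _ => ?_
    rw [← Real.exp_nat_mul]
    congr 1
    push_cast
    ring
  have hM : jointTail u w = W * s * t ^ 3 := by
    rw [jointTail_eq_prod hu, ← Finset.prod_pow, ← Finset.prod_mul_distrib,
      ← Finset.prod_mul_distrib]
    refine Finset.prod_congr rfl fun l _ => ?_
    rw [← Real.exp_nat_mul, ← Real.exp_add, ← Real.exp_add]
    congr 1
    push_cast
    rcases le_total (u l) (w l) with h | h
    · rw [max_eq_right h, abs_of_nonpos (by linarith)]
      ring
    · rw [max_eq_left h, abs_of_nonneg (by linarith)]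
      ring
  -- Only 3m of the N factors are used: m to absorb t, m to absorb s, and m that survive as (1 -
  -- `tailProb u`)^m and later integrate to `recordProb d m`.
  have hmiss : missProb u w ^ N ≤ (1 - s ^ 2) ^ (2 * m) * (1 - t ^ 2) ^ m := by
    have h0 := missProb_nonneg u w
    have hlu := missProb_le_left u w
    have hlw := missProb_le_right u w
    rw [hp] at hlu
    rw [hq] at hlw
    have hs2 : 0 ≤ 1 - s ^ 2 := by nlinarith
    calc missProb u w ^ N ≤ missProb u w ^ (2 * m + m) :=
          pow_le_pow_of_le_one h0 (missProb_le_one u w) (by omega)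
      _ = missProb u w ^ (2 * m) * missProb u w ^ m := pow_add _ _ _
      _ ≤ _ := by gcongr
  have h1 := mul_one_sub_sq_pow_le hs0 hs1 m
  have h2 := mul_one_sub_sq_pow_le ht0.le ht1 m
  have hs2 : 0 ≤ 1 - s ^ 2 := by nlinarith
  have ht2 : 0 ≤ 1 - t ^ 2 := by nlinarith
  calc jointTail u w / tailProb w * missProb u w ^ N
      ≤ (W * s * t) * ((1 - s ^ 2) ^ (2 * m) * (1 - t ^ 2) ^ m) := by
        have : jointTail u w / tailProb w = W * s * t := by
          rw [hM, hq]
          field_simp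
        rw [this]
        gcongr
    _ = (1 - s ^ 2) ^ m * ((s * (1 - s ^ 2) ^ m) * (t * (1 - t ^ 2) ^ m)) * W := by ring
    _ ≤ (1 - s ^ 2) ^ m * ((1 / √(2 * m + 1)) * (1 / √(2 * m + 1))) * W := by gcongr
    _ = _ := by
        rw [hp, ← mul_div_mul_comm, Real.mul_self_sqrt (by positivity)]
        ring

theorem lintegral_prod_exp_neg_half_abs_sub_le (u : Fin d → ℝ) :
    ∫⁻ w, ∏ l, ENNReal.ofReal (Real.exp (w l - |u l - w l| / 2)) ∂expLaw d ≤ 4 ^ d := by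
  rw [lintegral_fin_prod_eq_prod (expMeasure 1)
    (fun l y => ENNReal.ofReal (Real.exp (y - |u l - y| / 2))) fun l => by fun_prop]
  calc _ ≤ ∏ _l : Fin d, (4 : ℝ≥0∞) :=
        Finset.prod_le_prod' fun l _ => lintegral_exp_neg_half_abs_sub_le (u l)
    _ = 4 ^ d := by simp

theorem lintegral_pairIntegrand_le {m N : ℕ} (h : 4 * m ≤ N) :
    ∫⁻ q : (Fin d → ℝ) × (Fin d → ℝ),
      ENNReal.ofReal (jointTail q.1 q.2 / tailProb q.2 * missProb q.1 q.2 ^ N)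
        ∂(expLaw d).prod (expLaw d) ≤
      ENNReal.ofReal (recordProb d m / (2 * m + 1)) * 4 ^ d := by
  have hb (u : Fin d → ℝ) : 0 ≤ (1 - tailProb u) ^ m / (2 * m + 1) :=
    div_nonneg (pow_nonneg (by linarith [tailProb_le_one u]) m) (by positivity)
  have hae1 : ∀ᵐ q ∂(expLaw d).prod (expLaw d), ∀ l, 0 ≤ q.1 l :=
    Measure.quasiMeasurePreserving_fst.ae (ae_expLaw_nonneg d)
  have hae2 : ∀ᵐ q ∂(expLaw d).prod (expLaw d), ∀ l, 0 ≤ q.2 l :=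
    Measure.quasiMeasurePreserving_snd.ae (ae_expLaw_nonneg d)
  have hmeas : Measurable fun q : (Fin d → ℝ) × (Fin d → ℝ) =>
      ENNReal.ofReal ((1 - tailProb q.1) ^ m / (2 * m + 1)) *
        ∏ l, ENNReal.ofReal (Real.exp (q.2 l - |q.1 l - q.2 l| / 2)) := by
    refine Measurable.mul (by fun_prop) (Finset.measurable_fun_prod _ fun l _ => ?_)
    fun_prop
  calc _ ≤ ∫⁻ q : (Fin d → ℝ) × (Fin d → ℝ),
          ENNReal.ofReal ((1 - tailProb q.1) ^ m / (2 * m + 1)) *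
            ∏ l, ENNReal.ofReal (Real.exp (q.2 l - |q.1 l - q.2 l| / 2))
          ∂(expLaw d).prod (expLaw d) := by
        refine lintegral_mono_ae ?_
        filter_upwards [hae1, hae2] with q h1 h2
        rw [← ENNReal.ofReal_prod_of_nonneg fun l _ => (Real.exp_pos _).le,
          ← ENNReal.ofReal_mul (hb _)]
        exact ENNReal.ofReal_le_ofReal (pairIntegrand_le h h1 h2)
    _ = ∫⁻ u, ∫⁻ w, ENNReal.ofReal ((1 - tailProb u) ^ m / (2 * m + 1)) *
            ∏ l, ENNReal.ofReal (Real.exp (w l - |u l - w l| / 2)) ∂expLaw d ∂expLaw d :=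
        lintegral_prod _ hmeas.aemeasurable
    _ ≤ ∫⁻ u, ENNReal.ofReal ((1 - tailProb u) ^ m / (2 * m + 1)) * 4 ^ d ∂expLaw d := by
        refine lintegral_mono fun u => ?_
        rw [lintegral_const_mul' _ _ ENNReal.ofReal_ne_top]
        exact mul_le_mul_right (lintegral_prod_exp_neg_half_abs_sub_le u) _
    _ = ENNReal.ofReal (recordProb d m / (2 * m + 1)) * 4 ^ d := by
        rw [lintegral_mul_const _ (by fun_prop), ← ofReal_integral_eq_lintegral_ofReal
          ((integrable_one_sub_tailProb_pow m).div_const _) (ae_of_all _ hb), integral_div,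
          recordProb]

theorem pairIntegral_le {m N : ℕ} (h : 4 * m ≤ N) :
    pairIntegral d N ≤ 4 ^ d * (recordProb d m / (2 * m + 1)) := by
  have h0 : 0 ≤ recordProb d m / (2 * m + 1) :=
    div_nonneg (recordProb_nonneg _ _) (by positivity)
  have h1 : pairIntegral d N = (∫⁻ q : (Fin d → ℝ) × (Fin d → ℝ),
      ENNReal.ofReal (jointTail q.1 q.2 / tailProb q.2 * missProb q.1 q.2 ^ N)
        ∂(expLaw d).prod (expLaw d)).toReal :=
    integral_eq_lintegral_of_nonneg_ae (ae_of_all _ fun q => pairIntegrand_nonneg N q.1 q.2)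
      (measurable_pairIntegrand N).aestronglyMeasurable
  have h2 := ENNReal.toReal_mono
    (ENNReal.mul_ne_top ENNReal.ofReal_ne_top (ENNReal.pow_ne_top (by simp)))
    (lintegral_pairIntegrand_le (d := d) h)
  rw [h1]
  refine h2.trans (le_of_eq ?_)
  rw [ENNReal.toReal_mul, ENNReal.toReal_ofReal h0, ENNReal.toReal_pow, mul_comm]
  simp

end

/-! ### Conditioning on one or two observations -/

section

section Independence

variable {Ω E F : Type*} [MeasurableSpace Ω] [MeasurableSpace E] [MeasurableSpace F]
  {μ : Measure Ω} [IsProbabilityMeasure μ] {ν : Measure E} [IsProbabilityMeasure ν]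

/-- Given Y, the constraints on the different X i are independent, so Fubini turns the conditional
probability into a product. -/
theorem measureReal_forall_mem_of_indepFun {X : ℕ → Ω → E} (hX : ∀ k, Measurable (X k))
    (hindep : iIndepFun X μ) (hlaw : ∀ k, μ.map (X k) = ν) {Y : Ω → F} (hY : Measurable Y)
    (S : Finset ℕ) (hYS : IndepFun Y (fun ω (i : S) => X i ω) μ) (B : ℕ → Set (F × E))
    (hB : ∀ i, MeasurableSet (B i)) :
    μ.real {ω | ∀ i ∈ S, (Y ω, X i ω) ∈ B i} =
      ∫ y, ∏ i ∈ S, ν.real {x | (y, x) ∈ B i} ∂μ.map Y := by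
  have hXS : Measurable fun ω (i : S) => X i ω := measurable_pi_lambda _ fun i => hX i
  have hpi : μ.map (fun ω (i : S) => X i ω) = Measure.pi fun _ : S => ν := by
    have h := (iIndepFun_iff_map_fun_eq_pi_map (f := fun i : S => X i)
      fun i => (hX i).aemeasurable).1 (hindep.precomp Subtype.val_injective)
    rw [h]
    simp_rw [hlaw]
  have hprod := hYS.map_prod_eq_prod_map_map hY.aemeasurable hXS.aemeasurable
  rw [hpi] at hprod
  have : IsProbabilityMeasure (μ.map Y) := Measure.isProbabilityMeasure_map hY.aemeasurable
  set A : Set (F × (S → E)) := {t | ∀ i : S, (t.1, t.2 i) ∈ B i}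
  have hA : MeasurableSet A := by
    have : A = ⋂ i : S, (fun t : F × (S → E) => (t.1, t.2 i)) ⁻¹' B i := by
      ext t
      simp [A]
    rw [this]
    exact MeasurableSet.iInter fun i => (hB i).preimage (by fun_prop)
  have hset : {ω | ∀ i ∈ S, (Y ω, X i ω) ∈ B i} =
      (fun ω => (Y ω, fun i : S => X i ω)) ⁻¹' A := by
    ext ω
    simp [A]
  have hsec (y : F) : Prod.mk y ⁻¹' A = Set.univ.pi fun i : S => {x | (y, x) ∈ B i} := by
    ext t
    simp [A]
  rw [measureReal_def, hset, ← Measure.map_apply (hY.prodMk hXS) hA, hprod,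
    Measure.prod_apply hA, ← integral_toReal (measurable_measure_prodMk_left hA).aemeasurable
      (ae_of_all _ fun y => measure_lt_top _ _)]
  refine integral_congr_ae (ae_of_all _ fun y => ?_)
  simp only [hsec, Measure.pi_pi, ENNReal.toReal_prod, measureReal_def]
  exact Finset.prod_coe_sort S fun i => (ν {x | (y, x) ∈ B i}).toReal

end Independence

/-- Independent observations with independent standard exponential coordinates. -/
structure IsExpSample {Ω : Type*} [MeasurableSpace Ω] (μ : Measure Ω) {d : ℕ}
    (X : ℕ → Ω → Fin d → ℝ) : Prop where
  measurable : ∀ k, Measurable (X k)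
  indep : iIndepFun X μ
  law : ∀ k, μ.map (X k) = expLaw d

variable {Ω : Type*} [MeasurableSpace Ω] {μ : Measure Ω} [IsProbabilityMeasure μ] {d : ℕ}
  {X : ℕ → Ω → Fin d → ℝ}

namespace IsExpSample

theorem measureReal_not_strongLT (h : IsExpSample μ X) {k : ℕ} {S : Finset ℕ} (hk : k ∉ S) :
    μ.real {ω | ∀ i ∈ S, ¬ StrongLT (X k ω) (X i ω)} = recordProb d S.card := by
  have hind : IndepFun (X k) (fun ω (i : S) => X i ω) μ :=
    (h.indep.indepFun_finset {k} S (by simpa using hk) h.measurable).comp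
      (φ := fun t : ({k} : Finset ℕ) → Fin d → ℝ => t ⟨k, by simp⟩) (ψ := id)
      (measurable_pi_apply _) measurable_id
  have := measureReal_forall_mem_of_indepFun h.measurable h.indep h.law (h.measurable k) S hind
    (fun _ => {q | ¬ StrongLT q.1 q.2}) fun _ => measurableSet_strongLT_prod.compl
  simp only [Set.mem_ofPred_eq, one_sub_tailProb, Finset.prod_const, h.law] at this
  exact this

/-- Indices in S constrain both observations and those in T only the k-th. For records with j < k
these are the times before j and strictly between j and k; for current records T is empty. -/
theorem measureReal_pair (h : IsExpSample μ X) {j k : ℕ} (hjk : j ≠ k) {S T : Finset ℕ}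
    (hST : Disjoint S T) (hj : j ∉ S ∪ T) (hk : k ∉ S ∪ T) :
    μ.real {ω | (∀ i ∈ S, ¬ StrongLT (X j ω) (X i ω) ∧ ¬ StrongLT (X k ω) (X i ω)) ∧
        ∀ i ∈ T, ¬ StrongLT (X k ω) (X i ω)} =
      ∫ q : (Fin d → ℝ) × (Fin d → ℝ), missProb q.1 q.2 ^ S.card * (1 - tailProb q.2) ^ T.card
        ∂(expLaw d).prod (expLaw d) := by
  classical
  have hdisj : Disjoint ({j, k} : Finset ℕ) (S ∪ T) := by
    rw [Finset.disjoint_insert_left, Finset.disjoint_singleton_left]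
    exact ⟨hj, hk⟩
  have hind : IndepFun (fun ω => (X j ω, X k ω)) (fun ω (i : (S ∪ T : Finset ℕ)) => X i ω) μ :=
    (h.indep.indepFun_finset {j, k} (S ∪ T) hdisj h.measurable).comp
      (φ := fun t : ({j, k} : Finset ℕ) → Fin d → ℝ => (t ⟨j, by simp⟩, t ⟨k, by simp⟩)) (ψ := id)
      (by fun_prop) measurable_id
  have hmap : μ.map (fun ω => (X j ω, X k ω)) = (expLaw d).prod (expLaw d) := by
    rw [(h.indep.indepFun hjk).map_prod_eq_prod_map_map (h.measurable j).aemeasurable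
      (h.measurable k).aemeasurable, h.law, h.law]
  have := measureReal_forall_mem_of_indepFun h.measurable h.indep h.law
    ((h.measurable j).prodMk (h.measurable k)) (S ∪ T) hind
    (fun i => if i ∈ S then {q | ¬ StrongLT q.1.1 q.2 ∧ ¬ StrongLT q.1.2 q.2} else
      {q | ¬ StrongLT q.1.2 q.2}) fun i => by
        split_ifs
        · exact (measurableSet_strongLT (by fun_prop) (by fun_prop)).compl.inter
            (measurableSet_strongLT (by fun_prop) (by fun_prop)).compl
        · exact (measurableSet_strongLT (by fun_prop) (by fun_prop)).compl
  rw [hmap] at this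
  convert this using 1
  · congr 1
    ext ω
    simp only [Set.mem_ofPred_eq, Finset.mem_union]
    constructor
    · rintro ⟨h1, h2⟩ i hi
      split_ifs with hS
      · exact h1 i hS
      · exact h2 i (hi.resolve_left hS)
    · intro h
      refine ⟨fun i hi => ?_, fun i hi => ?_⟩
      · simpa [hi] using h i (Or.inl hi)
      · simpa [Finset.disjoint_right.1 hST hi] using h i (Or.inr hi)
  · congr 1
    ext q
    rw [Finset.prod_union hST]
    congr 1
    · rw [Finset.prod_congr rfl (g := fun _ => missProb q.1 q.2) fun i hi => by
        simp only [if_pos hi, Set.mem_ofPred_eq]; rfl]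
      simp
    · rw [Finset.prod_congr rfl (g := fun _ => 1 - tailProb q.2) fun i hi => by
        simp only [if_neg (Finset.disjoint_right.1 hST hi), Set.mem_ofPred_eq, one_sub_tailProb]]
      simp

end IsExpSample

end

/-! ### Variances of counts and covariance estimates -/

section

theorem sum_range_sum_range_eq_of_symm {c : ℕ → ℕ → ℝ} (hc : ∀ i j, c i j = c j i) (n : ℕ) :
    ∑ i ∈ Finset.range n, ∑ j ∈ Finset.range n, c i j =
      ∑ i ∈ Finset.range n, c i i + 2 * ∑ j ∈ Finset.range n, ∑ k ∈ Finset.Ico (j + 1) n, c j k := by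
  induction n with
  | zero => simp
  | succ n ih =>
    have h1 : ∑ j ∈ Finset.range (n + 1), ∑ k ∈ Finset.Ico (j + 1) (n + 1), c j k =
        ∑ j ∈ Finset.range n, ∑ k ∈ Finset.Ico (j + 1) n, c j k + ∑ j ∈ Finset.range n, c j n := by
      rw [Finset.sum_range_succ, Finset.Ico_self, Finset.sum_empty, add_zero,
        ← Finset.sum_add_distrib]
      exact Finset.sum_congr rfl fun j hj =>
        Finset.sum_Ico_succ_top (Nat.succ_le_of_lt (Finset.mem_range.1 hj)) _
    simp only [Finset.sum_range_succ _ n, Finset.sum_add_distrib] at h1 ⊢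
    rw [h1, ih, Finset.sum_congr rfl fun i (_ : i ∈ Finset.range n) => hc n i]
    ring

section Counting

variable {Ω : Type*} [MeasurableSpace Ω] {μ : Measure Ω} [IsProbabilityMeasure μ]

theorem variance_sum_indicator_le {A : ℕ → Set Ω} (hA : ∀ k, MeasurableSet (A k)) (n : ℕ) :
    variance (fun ω => ∑ k ∈ Finset.range n, (A k).indicator (fun _ => (1 : ℝ)) ω) μ ≤
      ∑ k ∈ Finset.range n, μ.real (A k) + 2 * ∑ j ∈ Finset.range n, ∑ k ∈ Finset.Ico (j + 1) n,
        (μ.real (A j ∩ A k) - μ.real (A j) * μ.real (A k)) := by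
  have hmem (k : ℕ) : MemLp ((A k).indicator fun _ => (1 : ℝ)) 2 μ :=
    memLp_indicator_const 2 (hA k) 1 (Or.inr (measure_ne_top _ _))
  have hcov (j k : ℕ) : cov[(A j).indicator fun _ => (1 : ℝ), (A k).indicator fun _ => (1 : ℝ); μ] =
      μ.real (A j ∩ A k) - μ.real (A j) * μ.real (A k) := by
    rw [covariance_eq_sub (hmem j) (hmem k)]
    have : ((A j).indicator fun _ => (1 : ℝ)) * ((A k).indicator fun _ => (1 : ℝ)) =
        (A j ∩ A k).indicator fun _ => (1 : ℝ) := by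
      ext ω
      by_cases h1 : ω ∈ A j <;> by_cases h2 : ω ∈ A k <;> simp [h1, h2]
    rw [this, integral_indicator_const _ (hA j), integral_indicator_const _ (hA k),
      integral_indicator_const _ ((hA j).inter (hA k))]
    simp
  have h := variance_sum' (s := Finset.range n) fun k _ => hmem k
  have hfun : (fun ω => ∑ k ∈ Finset.range n, (A k).indicator (fun _ => (1 : ℝ)) ω) =
      ∑ k ∈ Finset.range n, (A k).indicator fun _ => (1 : ℝ) := by
    ext ω
    simp
  simp_rw [hcov] at h
  rw [hfun, h, sum_range_sum_range_eq_of_symm fun i j => by rw [Set.inter_comm, mul_comm]]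
  gcongr with k
  rw [Set.inter_self]
  nlinarith [measureReal_nonneg (μ := μ) (s := A k)]

theorem integral_sum_indicator {A : ℕ → Set Ω} (hA : ∀ k, MeasurableSet (A k)) (n : ℕ) :
    ∫ ω, ∑ k ∈ Finset.range n, (A k).indicator (fun _ => (1 : ℝ)) ω ∂μ =
      ∑ k ∈ Finset.range n, μ.real (A k) := by
  rw [integral_finsetSum _ fun k _ => (integrable_const (1 : ℝ)).indicator (hA k)]
  refine Finset.sum_congr rfl fun k _ => ?_
  rw [integral_indicator_const _ (hA k), smul_eq_mul, mul_one]

theorem memLp_sum_indicator {A : ℕ → Set Ω} (hA : ∀ k, MeasurableSet (A k)) (n : ℕ) :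
    MemLp (fun ω => ∑ k ∈ Finset.range n, (A k).indicator (fun _ => (1 : ℝ)) ω) 2 μ :=
  memLp_finsetSum _ fun k _ => memLp_indicator_const 2 (hA k) 1 (Or.inr (measure_ne_top _ _))

end Counting

theorem pow_sub_pow_le_mul {a b M : ℝ} (ha : 0 ≤ a) (hb : 0 ≤ b) (hM : 0 ≤ M) (hab : a - b ≤ M)
    (j : ℕ) : a ^ j - b ^ j ≤ j * M * a ^ (j - 1) := by
  rcases le_total a b with h | h
  · have : a ^ j ≤ b ^ j := pow_le_pow_left₀ ha h j
    have : 0 ≤ j * M * a ^ (j - 1) := by positivity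
    linarith
  · rw [← (Commute.all a b).geom_sum₂_mul]
    have hs : ∑ i ∈ Finset.range j, a ^ i * b ^ (j - 1 - i) ≤ ∑ i ∈ Finset.range j, a ^ (j - 1) := by
      refine Finset.sum_le_sum fun i hi => ?_
      have hij : i ≤ j - 1 := by
        have := Finset.mem_range.1 hi
        omega
      rw [← pow_mul_pow_sub a hij]
      gcongr
    calc _ ≤ (∑ i ∈ Finset.range j, a ^ (j - 1)) * M :=
          mul_le_mul hs hab (by linarith) (Finset.sum_nonneg fun _ _ => by positivity)
      _ = _ := by
          simp
          ring

variable {d : ℕ}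

theorem missProb_sub_le (u w : Fin d → ℝ) :
    missProb u w - (1 - tailProb u) * (1 - tailProb w) ≤ jointTail u w := by
  rw [missProb_eq]
  nlinarith [mul_nonneg (tailProb_nonneg u) (tailProb_nonneg w)]

theorem integrable_missProb_pow_mul (i j : ℕ) :
    Integrable (fun q : (Fin d → ℝ) × (Fin d → ℝ) => missProb q.1 q.2 ^ j * (1 - tailProb q.2) ^ i)
      ((expLaw d).prod (expLaw d)) := by
  have hm : Measurable fun q : (Fin d → ℝ) × (Fin d → ℝ) =>
      missProb q.1 q.2 ^ j * (1 - tailProb q.2) ^ i :=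
    (measurable_missProb.pow_const j).mul (by fun_prop)
  refine Integrable.of_bound hm.aestronglyMeasurable 1 (ae_of_all _ fun q => ?_)
  have h0 := missProb_nonneg q.1 q.2
  have h1 : 0 ≤ 1 - tailProb q.2 := by linarith [tailProb_le_one q.2]
  rw [Real.norm_of_nonneg (by positivity)]
  exact mul_le_one₀ (pow_le_one₀ h0 (missProb_le_one _ _)) (by positivity)
    (pow_le_one₀ h1 (by linarith [tailProb_nonneg q.2]))

theorem integrable_one_sub_tailProb_pow_mul (i j : ℕ) :
    Integrable (fun q : (Fin d → ℝ) × (Fin d → ℝ) =>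
      (1 - tailProb q.1) ^ i * (1 - tailProb q.2) ^ j) ((expLaw d).prod (expLaw d)) :=
  (integrable_one_sub_tailProb_pow i).mul_prod (integrable_one_sub_tailProb_pow j)

theorem recordProb_mul_recordProb (d i j : ℕ) :
    recordProb d i * recordProb d j = ∫ q : (Fin d → ℝ) × (Fin d → ℝ),
      (1 - tailProb q.1) ^ i * (1 - tailProb q.2) ^ j ∂(expLaw d).prod (expLaw d) :=
  (integral_prod_mul (fun x => (1 - tailProb x) ^ i) fun x => (1 - tailProb x) ^ j).symm

/-- The i-th term is (1-q)^i times a difference of j-th powers, plus a correction carrying a factor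
q. The geometric sum s satisfies s q ≤ 1: it turns the joint tail M in the first part into M/q and
removes the factor q from the second. -/
theorem sum_pair_excess_le (u w : Fin d → ℝ) (j m : ℕ) :
    ∑ i ∈ Finset.range m, (missProb u w ^ j * (1 - tailProb w) ^ i -
        (1 - tailProb u) ^ j * (1 - tailProb w) ^ (j + 1 + i)) ≤
      j * (jointTail u w / tailProb w * missProb u w ^ (j - 1)) +
        (1 - tailProb u) ^ j * (1 - tailProb w) ^ 0 := by
  have ha := missProb_nonneg u w
  have hM := jointTail_nonneg u w
  have hMq := jointTail_le_right u w
  have hab := missProb_sub_le u w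
  have hp0 : 0 ≤ 1 - tailProb u := by linarith [tailProb_le_one u]
  have hq0 : 0 ≤ 1 - tailProb w := by linarith [tailProb_le_one w]
  have hq : 0 ≤ tailProb w := tailProb_nonneg w
  generalize missProb u w = a at *
  generalize jointTail u w = M at *
  -- Here p is the probability of not dominating u, whereas q below is the probability of dominating
  -- w.
  generalize 1 - tailProb u = p at *
  generalize tailProb w = q at *
  have hgeom : (∑ i ∈ Finset.range m, (1 - q) ^ i) * q = 1 - (1 - q) ^ m := by
    have := geom_sum_mul_neg (1 - q) m
    rwa [sub_sub_cancel] at this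
  have hsum0 : 0 ≤ ∑ i ∈ Finset.range m, (1 - q) ^ i := Finset.sum_nonneg fun _ _ => by positivity
  set s := ∑ i ∈ Finset.range m, (1 - q) ^ i
  have hsq : s * q ≤ 1 := by
    have : 0 ≤ (1 - q) ^ m := by positivity
    linarith
  have hsM : s * M ≤ M / q := by
    rcases hq.eq_or_lt with h | h
    · have : M = 0 := by linarith
      simp [this]
    · rw [le_div_iff₀ h]
      nlinarith
  have hpow := pow_sub_pow_le_mul ha (mul_nonneg hp0 hq0) hM hab j
  calc ∑ i ∈ Finset.range m, (a ^ j * (1 - q) ^ i - p ^ j * (1 - q) ^ (j + 1 + i))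
      = s * (a ^ j - (p * (1 - q)) ^ j) + (s * q) * (p ^ j * (1 - q) ^ j) := by
        simp only [s, Finset.sum_mul]
        rw [← Finset.sum_add_distrib]
        refine Finset.sum_congr rfl fun i _ => ?_
        rw [mul_pow]
        ring
    _ ≤ s * (j * M * a ^ (j - 1)) + 1 * (p ^ j * 1) := by
        gcongr
        exact pow_le_one₀ hq0 (by linarith)
    _ = j * ((s * M) * a ^ (j - 1)) + p ^ j * (1 - q) ^ 0 := by ring
    _ ≤ _ := by gcongr

/-- There is no sum over later times to produce 1/q here. Instead about half of the power of the
miss probability is spent on the bound N q (1-q)^((N-1)/2) ≤ 2. The last term pays for the exponents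
N + 1 in the product of the two probabilities. -/
theorem pair_excess_le (u w : Fin d → ℝ) (N : ℕ) :
    missProb u w ^ N - (1 - tailProb u) ^ (N + 1) * (1 - tailProb w) ^ (N + 1) ≤
      2 * (jointTail u w / tailProb w * missProb u w ^ ((N - 1) - (N - 1) / 2)) +
        ((1 - tailProb u) ^ N * (1 - tailProb w) ^ 0 +
          (1 - tailProb u) ^ 0 * (1 - tailProb w) ^ N) / (N + 1) := by
  have ha := missProb_nonneg u w
  have hM := jointTail_nonneg u w
  have hMq := jointTail_le_right u w
  have hab := missProb_sub_le u w
  have haw := missProb_le_right u w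
  have hp0 : 0 ≤ 1 - tailProb u := by linarith [tailProb_le_one u]
  have hq0 : 0 ≤ 1 - tailProb w := by linarith [tailProb_le_one w]
  have hp : 0 ≤ tailProb u := tailProb_nonneg u
  have hq : 0 ≤ tailProb w := tailProb_nonneg w
  generalize missProb u w = a at *
  generalize jointTail u w = M at *
  generalize tailProb u = p at *
  generalize tailProb w = q at *
  have hpow := pow_sub_pow_le_mul ha (mul_nonneg hp0 hq0) hM hab N
  have hP := succ_mul_mul_one_sub_pow_le hp (by linarith) N
  have hQ := succ_mul_mul_one_sub_pow_le hq (by linarith) N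
  have hp1 : (1 - p) ^ N ≤ 1 := pow_le_one₀ hp0 (by linarith)
  have hq1 : (1 - q) ^ N ≤ 1 := pow_le_one₀ hq0 (by linarith)
  have hpN : 0 ≤ (1 - p) ^ N := by positivity
  have hqN : 0 ≤ (1 - q) ^ N := by positivity
  have hN : (0 : ℝ) < N + 1 := by positivity
  have hsecond : ((1 - p) * (1 - q)) ^ N - (1 - p) ^ (N + 1) * (1 - q) ^ (N + 1) ≤
      ((1 - p) ^ N * (1 - q) ^ 0 + (1 - p) ^ 0 * (1 - q) ^ N) / (N + 1) := by
    rw [le_div_iff₀ hN, mul_pow]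
    have h1 : (N + 1) * (p * (1 - p) ^ N) * (1 - q) ^ N ≤ 1 * (1 - q) ^ N := by gcongr
    have h2 : (N + 1) * (q * (1 - q) ^ N) * (1 - p) ^ N ≤ 1 * (1 - p) ^ N := by gcongr
    have h3 : 0 ≤ (N + 1) * (p * q * ((1 - p) ^ N * (1 - q) ^ N)) := by positivity
    have h4 : ((1 - p) ^ N * (1 - q) ^ N - (1 - p) ^ (N + 1) * (1 - q) ^ (N + 1)) * (N + 1) =
        (N + 1) * (p * (1 - p) ^ N) * (1 - q) ^ N + (N + 1) * (q * (1 - q) ^ N) * (1 - p) ^ N -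
          (N + 1) * (p * q * ((1 - p) ^ N * (1 - q) ^ N)) := by ring
    rw [h4]
    simp only [pow_zero]
    linarith
  have hfirst : N * M * a ^ (N - 1) ≤ 2 * (M / q * a ^ ((N - 1) - (N - 1) / 2)) := by
    rcases hq.eq_or_lt with h | h
    · have : M = 0 := by linarith
      simp [this]
    · set i := N - 1
      have hNi : (N : ℝ) ≤ 2 * (((i / 2 : ℕ) : ℝ) + 1) := by
        have : N ≤ 2 * (i / 2 + 1) := by omega
        exact_mod_cast this
      have hQ' := succ_mul_mul_one_sub_pow_le hq (by linarith) (i / 2)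
      have hqa : q * a ^ (i / 2) ≤ q * (1 - q) ^ (i / 2) := by gcongr
      have hbound : N * (q * a ^ (i / 2)) ≤ 2 := by
        have h0 : 0 ≤ q * a ^ (i / 2) := by positivity
        nlinarith
      have hsplit : a ^ i = a ^ (i / 2) * a ^ (i - i / 2) := by
        rw [← pow_add]
        congr 1
        omega
      calc N * M * a ^ i = (N * (q * a ^ (i / 2))) * (M / q * a ^ (i - i / 2)) := by
            rw [hsplit]
            field_simp
        _ ≤ _ := by gcongr
  linarith

end

/-! ### Variance of the record count and pairs of current records -/

section

theorem not_strongLT_self {d : ℕ} (hd : 1 ≤ d) (x : Fin d → ℝ) : ¬ StrongLT x x :=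
  fun h => lt_irrefl _ (h ⟨0, hd⟩)

theorem R_eq_sum_indicator {Ω : Type*} {d : ℕ} (X : ℕ → Ω → Fin d → ℝ) (n : ℕ) : R X n = fun ω =>
    ∑ k ∈ Finset.range n, {ω | IsRecord (fun i => X i ω) k}.indicator (fun _ => (1 : ℝ)) ω := by
  classical
  ext ω
  simp [R, recordCount, Set.indicator_apply]

theorem r_eq_sum_indicator {Ω : Type*} {d : ℕ} (X : ℕ → Ω → Fin d → ℝ) (n : ℕ) : r X n = fun ω =>
    ∑ k ∈ Finset.range n,
      {ω | IsCurrentRecord (fun i => X i ω) n k}.indicator (fun _ => (1 : ℝ)) ω := by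
  classical
  ext ω
  simp [r, currentCount, Set.indicator_apply]

theorem r_add_β {Ω : Type*} {d : ℕ} (hd : 1 ≤ d) (X : ℕ → Ω → Fin d → ℝ) (n : ℕ) (ω : Ω) :
    r X n ω + β X n ω = R X n ω := by
  simp only [r, β, R]
  exact_mod_cast currentCount_add_brokenCount hd _ n

variable {Ω : Type*} [MeasurableSpace Ω] {μ : Measure Ω} [IsProbabilityMeasure μ] {d : ℕ}
  {X : ℕ → Ω → Fin d → ℝ}

theorem measurableSet_isCurrentRecord (hX : ∀ k, Measurable (X k)) (n k : ℕ) :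
    MeasurableSet {ω | IsCurrentRecord (fun i => X i ω) n k} := by
  simp only [IsCurrentRecord, Set.ofPred_forall]
  exact MeasurableSet.iInter fun i => MeasurableSet.iInter fun _ =>
    (measurableSet_strongLT (hX k) (hX i)).compl

theorem measurableSet_isRecord (hX : ∀ k, Measurable (X k)) (k : ℕ) :
    MeasurableSet {ω | IsRecord (fun i => X i ω) k} :=
  measurableSet_isCurrentRecord hX k k

namespace IsExpSample

theorem measureReal_isRecord (h : IsExpSample μ X) (k : ℕ) :
    μ.real {ω | IsRecord (fun i => X i ω) k} = recordProb d k := by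
  have := h.measureReal_not_strongLT (k := k) (S := Finset.range k) (by simp)
  simpa [IsRecord] using this

theorem measureReal_isCurrentRecord (h : IsExpSample μ X) (hd : 1 ≤ d) {n k : ℕ} (hk : k < n) :
    μ.real {ω | IsCurrentRecord (fun i => X i ω) n k} = recordProb d (n - 1) := by
  have := h.measureReal_not_strongLT (k := k) (S := (Finset.range n).erase k) (by simp)
  rw [Finset.card_erase_of_mem (Finset.mem_range.2 hk), Finset.card_range] at this
  rw [← this]
  congr 1
  ext ω
  simp only [IsCurrentRecord, Set.mem_ofPred_eq, Finset.mem_erase, Finset.mem_range]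
  refine ⟨fun H i hi => H i hi.2, fun H i hi => ?_⟩
  by_cases hik : i = k
  · rw [hik]
    exact not_strongLT_self hd _
  · exact H i ⟨hik, hi⟩

theorem integral_R (h : IsExpSample μ X) (n : ℕ) : ∫ ω, R X n ω ∂μ = recordMean d n := by
  rw [R_eq_sum_indicator, integral_sum_indicator (measurableSet_isRecord h.measurable), recordMean]
  exact Finset.sum_congr rfl fun k _ => h.measureReal_isRecord k

theorem memLp_R (h : IsExpSample μ X) (n : ℕ) : MemLp (R X n) 2 μ := by
  rw [R_eq_sum_indicator]
  exact memLp_sum_indicator (measurableSet_isRecord h.measurable) n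

theorem memLp_r (h : IsExpSample μ X) (n : ℕ) : MemLp (r X n) 2 μ := by
  rw [r_eq_sum_indicator]
  exact memLp_sum_indicator (measurableSet_isCurrentRecord h.measurable n) n

/-- The earlier record j is fixed and the covariances with all later ones are summed before
estimating, so that the geometric series in the gap k - j - 1 is available. -/
theorem sum_recordPair_le (h : IsExpSample μ X) (j n : ℕ) :
    ∑ k ∈ Finset.Ico (j + 1) n,
      (μ.real ({ω | IsRecord (fun i => X i ω) j} ∩ {ω | IsRecord (fun i => X i ω) k}) -
        μ.real {ω | IsRecord (fun i => X i ω) j} * μ.real {ω | IsRecord (fun i => X i ω) k}) ≤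
      j * pairIntegral d (j - 1) + recordProb d j := by
  rw [Finset.sum_Ico_eq_sum_range]
  set m := n - (j + 1)
  calc _ ≤ ∑ i ∈ Finset.range m, ∫ q : (Fin d → ℝ) × (Fin d → ℝ),
          (missProb q.1 q.2 ^ j * (1 - tailProb q.2) ^ i -
            (1 - tailProb q.1) ^ j * (1 - tailProb q.2) ^ (j + 1 + i))
          ∂(expLaw d).prod (expLaw d) := by
        refine Finset.sum_le_sum fun i _ => ?_
        rw [integral_sub (integrable_missProb_pow_mul i j)
          (integrable_one_sub_tailProb_pow_mul j _), ← recordProb_mul_recordProb,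
          h.measureReal_isRecord, h.measureReal_isRecord]
        have hpair := h.measureReal_pair (j := j) (k := j + 1 + i) (by omega)
          (S := Finset.range j) (T := Finset.Ico (j + 1) (j + 1 + i))
          (Finset.disjoint_left.2 fun a h1 h2 => by
            simp only [Finset.mem_range, Finset.mem_Ico] at h1 h2
            omega) (by simp) (by simp [Finset.mem_union]; omega)
        rw [Finset.card_range, Nat.card_Ico, Nat.add_sub_cancel_left] at hpair
        rw [← hpair]
        gcongr
        · exact measure_ne_top _ _
        -- The requirement that observation j does not dominate observation k is dropped; only an
        -- upper bound is needed.
        · rintro ω ⟨h1, h2⟩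
          refine ⟨fun a ha => ?_, fun a ha => ?_⟩
          · have ha' := Finset.mem_range.1 ha
            exact ⟨h1 a ha', h2 a (by omega)⟩
          · exact h2 a (Finset.mem_Ico.1 ha).2
    _ = ∫ q : (Fin d → ℝ) × (Fin d → ℝ), ∑ i ∈ Finset.range m,
          (missProb q.1 q.2 ^ j * (1 - tailProb q.2) ^ i -
            (1 - tailProb q.1) ^ j * (1 - tailProb q.2) ^ (j + 1 + i))
          ∂(expLaw d).prod (expLaw d) :=
        (integral_finsetSum _ fun i _ => (integrable_missProb_pow_mul i j).sub
          (integrable_one_sub_tailProb_pow_mul j _)).symm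
    _ ≤ ∫ q : (Fin d → ℝ) × (Fin d → ℝ),
          (j * (jointTail q.1 q.2 / tailProb q.2 * missProb q.1 q.2 ^ (j - 1)) +
            (1 - tailProb q.1) ^ j * (1 - tailProb q.2) ^ 0) ∂(expLaw d).prod (expLaw d) :=
        integral_mono (integrable_finsetSum _ fun i _ => (integrable_missProb_pow_mul i j).sub
            (integrable_one_sub_tailProb_pow_mul j _))
          (((integrable_pairIntegrand (j - 1)).const_mul _).add
            (integrable_one_sub_tailProb_pow_mul j 0))
          fun q => sum_pair_excess_le q.1 q.2 j m
    _ = j * pairIntegral d (j - 1) + recordProb d j := by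
        rw [integral_add ((integrable_pairIntegrand (j - 1)).const_mul _)
            (integrable_one_sub_tailProb_pow_mul j 0), integral_const_mul, pairIntegral,
          ← recordProb_mul_recordProb]
        simp [recordProb]

/-- With m = i/4 the pair integral is at most a constant times `recordProb d (i / 4)` / (i + 1), so
the weight j cancels. Each value of i/4 occurs at most four times. -/
theorem sum_mul_pairIntegral_le (d n : ℕ) :
    ∑ j ∈ Finset.range n, j * pairIntegral d (j - 1) ≤ 16 * 4 ^ d * recordMean d n := by
  rcases n with _ | n
  · simp [recordMean]
  rw [Finset.sum_range_succ']
  have hstep (i : ℕ) : (i + 1 : ℝ) * pairIntegral d i ≤ 4 * 4 ^ d * recordProb d (i / 4) := by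
    have h1 := pairIntegral_le (d := d) (m := i / 4) (N := i) (Nat.mul_div_le i 4)
    have h2 : (i : ℝ) + 1 ≤ 4 * (2 * (i / 4 : ℕ) + 1) := by
      have : i + 1 ≤ 4 * (2 * (i / 4) + 1) := by omega
      exact_mod_cast this
    have hf := recordProb_nonneg d (i / 4)
    have hK := pairIntegral_nonneg d i
    calc (i + 1 : ℝ) * pairIntegral d i
        ≤ (4 * (2 * (i / 4 : ℕ) + 1)) * (4 ^ d * (recordProb d (i / 4) / (2 * (i / 4 : ℕ) + 1))) := by
          gcongr
      _ = _ := by field_simp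
  calc _ = ∑ i ∈ Finset.range n, (i + 1 : ℝ) * pairIntegral d i := by simp
    _ ≤ ∑ i ∈ Finset.range n, 4 * 4 ^ d * recordProb d (i / 4) :=
        Finset.sum_le_sum fun i _ => hstep i
    _ = 4 * 4 ^ d * ∑ i ∈ Finset.range n, recordProb d (i / 4) := (Finset.mul_sum _ _ _).symm
    _ ≤ 4 * 4 ^ d * (4 * recordMean d n) := by
        gcongr
        exact sum_div_four_le (recordProb_nonneg d) n
    _ ≤ 4 * 4 ^ d * (4 * recordMean d (n + 1)) := by
        gcongr
        exact recordMean_mono d n.le_succ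
    _ = _ := by ring

theorem variance_R_le (h : IsExpSample μ X) (n : ℕ) :
    variance (R X n) μ ≤ (3 + 32 * 4 ^ d) * recordMean d n := by
  rw [R_eq_sum_indicator]
  refine (variance_sum_indicator_le (measurableSet_isRecord h.measurable) n).trans ?_
  have h1 := Finset.sum_le_sum fun j (_ : j ∈ Finset.range n) => h.sum_recordPair_le j n
  rw [Finset.sum_add_distrib] at h1
  have h2 := sum_mul_pairIntegral_le d n
  have h3 : ∑ k ∈ Finset.range n, μ.real {ω | IsRecord (fun i => X i ω) k} = recordMean d n :=
    Finset.sum_congr rfl fun k _ => h.measureReal_isRecord k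
  change _ ≤ _ + recordMean d n at h1
  rw [h3]
  linarith

/-- Comparisons between observations j and k are dropped, leaving N common observations, while each
marginal probability involves N + 1. -/
theorem currentPair_le (h : IsExpSample μ X) (hd : 1 ≤ d) {N j k : ℕ} (hj : j < N + 2)
    (hk : k < N + 2) (hjk : j ≠ k) :
    μ.real ({ω | IsCurrentRecord (fun i => X i ω) (N + 2) j} ∩
        {ω | IsCurrentRecord (fun i => X i ω) (N + 2) k}) -
      μ.real {ω | IsCurrentRecord (fun i => X i ω) (N + 2) j} *
        μ.real {ω | IsCurrentRecord (fun i => X i ω) (N + 2) k} ≤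
      2 * pairIntegral d ((N - 1) - (N - 1) / 2) + 2 * recordProb d N / (N + 1) := by
  have hpair := h.measureReal_pair hjk (S := ((Finset.range (N + 2)).erase j).erase k) (T := ∅)
    (by simp) (by simp) (by simp)
  rw [Finset.card_erase_of_mem (by simp [hk, hjk.symm]), Finset.card_erase_of_mem (by simpa using hj),
    Finset.card_range, Finset.card_empty] at hpair
  have hint : Integrable (fun q : (Fin d → ℝ) × (Fin d → ℝ) =>
      ((1 - tailProb q.1) ^ N * (1 - tailProb q.2) ^ 0 +
        (1 - tailProb q.1) ^ 0 * (1 - tailProb q.2) ^ N) / ((N : ℝ) + 1))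
      ((expLaw d).prod (expLaw d)) :=
    ((integrable_one_sub_tailProb_pow_mul N 0).add
      (integrable_one_sub_tailProb_pow_mul 0 N)).div_const _
  calc _ ≤ ∫ q : (Fin d → ℝ) × (Fin d → ℝ),
          (missProb q.1 q.2 ^ N * (1 - tailProb q.2) ^ 0 -
            (1 - tailProb q.1) ^ (N + 1) * (1 - tailProb q.2) ^ (N + 1))
          ∂(expLaw d).prod (expLaw d) := by
        rw [integral_sub (integrable_missProb_pow_mul 0 N)
          (integrable_one_sub_tailProb_pow_mul _ _), ← recordProb_mul_recordProb,
          h.measureReal_isCurrentRecord hd hj, h.measureReal_isCurrentRecord hd hk]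
        refine sub_le_sub_right (le_trans ?_ hpair.le) _
        refine measureReal_mono ?_
        rintro ω ⟨h1, h2⟩
        refine ⟨fun a ha => ?_, by simp⟩
        have ha' : a < N + 2 := by
          simp only [Finset.mem_erase, Finset.mem_range] at ha
          exact ha.2.2
        exact ⟨h1 a ha', h2 a ha'⟩
    _ ≤ ∫ q : (Fin d → ℝ) × (Fin d → ℝ),
          (2 * (jointTail q.1 q.2 / tailProb q.2 * missProb q.1 q.2 ^ ((N - 1) - (N - 1) / 2)) +
          ((1 - tailProb q.1) ^ N * (1 - tailProb q.2) ^ 0 +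
            (1 - tailProb q.1) ^ 0 * (1 - tailProb q.2) ^ N) / (N + 1))
          ∂(expLaw d).prod (expLaw d) := by
        refine integral_mono ((integrable_missProb_pow_mul 0 N).sub
          (integrable_one_sub_tailProb_pow_mul _ _)) (((integrable_pairIntegrand _).const_mul _).add hint) fun q => ?_
        have := pair_excess_le q.1 q.2 N
        simpa only [pow_zero, mul_one] using this
    _ = _ := by
        rw [integral_add ((integrable_pairIntegrand _).const_mul _) hint, integral_const_mul,
          integral_div, integral_add (integrable_one_sub_tailProb_pow_mul N 0)
              (integrable_one_sub_tailProb_pow_mul 0 N), ← recordProb_mul_recordProb,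
          ← recordProb_mul_recordProb, pairIntegral]
        have : recordProb d 0 = 1 := by simp [recordProb]
        rw [this]
        ring

end IsExpSample

end

/-! ### Variance of the remaining and broken record counts -/

section

theorem β_eq_sub {Ω : Type*} {d : ℕ} (X : ℕ → Ω → Fin (d + 1) → ℝ) (n : ℕ) : β X n = R X n - r X n := by
  ext ω
  rw [Pi.sub_apply, ← r_add_β (Nat.le_add_left 1 d)]
  ring

namespace IsExpSample

variable {Ω : Type*} [MeasurableSpace Ω] {μ : Measure Ω} [IsProbabilityMeasure μ] {d : ℕ}
  {X : ℕ → Ω → Fin (d + 1) → ℝ}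

theorem sum_measureReal_isCurrentRecord (h : IsExpSample μ X) (n : ℕ) :
    ∑ k ∈ Finset.range n, μ.real {ω | IsCurrentRecord (fun i => X i ω) n k} = recordMean d n := by
  rw [Finset.sum_congr rfl fun k hk =>
    h.measureReal_isCurrentRecord (Nat.le_add_left 1 d) (Finset.mem_range.1 hk)]
  rcases n with _ | n
  · simp [recordMean]
  · simp [← succ_mul_recordProb]

theorem integral_r (h : IsExpSample μ X) (n : ℕ) : ∫ ω, r X n ω ∂μ = recordMean d n := by
  rw [r_eq_sum_indicator, integral_sum_indicator (measurableSet_isCurrentRecord h.measurable n),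
    h.sum_measureReal_isCurrentRecord]

/-- About N² pairs each contribute O(`recordProb (d + 1) m` / (m + 1)) with m of order N. This
totals O(m `recordProb (d + 1) m`), which the recursion bounds by `recordMean d`. -/
theorem variance_r_le (h : IsExpSample μ X) (n : ℕ) :
    variance (r X n) μ ≤ (17 + 400 * 4 ^ (d + 1)) * recordMean d n := by
  rw [r_eq_sum_indicator]
  refine (variance_sum_indicator_le (measurableSet_isCurrentRecord h.measurable n) n).trans ?_
  rw [h.sum_measureReal_isCurrentRecord]
  have hR := recordMean_nonneg d n
  suffices hs : ∑ j ∈ Finset.range n, ∑ k ∈ Finset.Ico (j + 1) n,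
      (μ.real ({ω | IsCurrentRecord (fun i => X i ω) n j} ∩
        {ω | IsCurrentRecord (fun i => X i ω) n k}) -
      μ.real {ω | IsCurrentRecord (fun i => X i ω) n j} *
        μ.real {ω | IsCurrentRecord (fun i => X i ω) n k}) ≤
      (8 + 200 * 4 ^ (d + 1)) * recordMean d n by linarith
  rcases n with _ | _ | N
  · simp [recordMean]
  · simp only [zero_add, Finset.range_one, Finset.sum_singleton, Finset.Ico_self, Finset.sum_empty]
    positivity
  set B := 2 * pairIntegral (d + 1) ((N - 1) - (N - 1) / 2) + 2 * recordProb (d + 1) N / (N + 1)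
  have hB : 0 ≤ B := add_nonneg (mul_nonneg zero_le_two (pairIntegral_nonneg _ _))
    (div_nonneg (mul_nonneg zero_le_two (recordProb_nonneg _ _)) (by positivity))
  have h1 : ((N : ℝ) + 2) ^ 2 * pairIntegral (d + 1) ((N - 1) - (N - 1) / 2) ≤
      100 * 4 ^ (d + 1) * recordMean d (N + 2) := by
    -- The exponent is about (N-1)/2 and `pairIntegral_le` needs four times m below it. The factor
    -- 10 below absorbs the rounding and is attained at N = 8.
    set m := (N - 1) / 8
    have hK := pairIntegral_le (d := d + 1) (m := m) (N := (N - 1) - (N - 1) / 2) (by omega)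
    have hn : (N : ℝ) + 2 ≤ 10 * (m + 1) := by
      have : N + 2 ≤ 10 * (m + 1) := by omega
      exact_mod_cast this
    have hm : ((m : ℝ) + 1) * recordProb (d + 1) m ≤ recordMean d (N + 2) := by
      rw [succ_mul_recordProb]
      exact recordMean_mono d (by omega)
    have hf := recordProb_nonneg (d + 1) m
    have hK0 := pairIntegral_nonneg (d + 1) ((N - 1) - (N - 1) / 2)
    calc _ ≤ (10 * ((m : ℝ) + 1)) ^ 2 * (4 ^ (d + 1) * (recordProb (d + 1) m / (2 * m + 1))) := by
          gcongr
      _ ≤ (10 * ((m : ℝ) + 1)) ^ 2 * (4 ^ (d + 1) * (recordProb (d + 1) m / (m + 1))) := by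
          gcongr
          linarith [m.cast_nonneg (α := ℝ)]
      _ = 100 * 4 ^ (d + 1) * (((m : ℝ) + 1) * recordProb (d + 1) m) := by field_simp; ring
      _ ≤ _ := by gcongr
  have h2 : ((N : ℝ) + 2) ^ 2 * (recordProb (d + 1) N / (N + 1)) ≤ 4 * recordMean d (N + 2) := by
    have hm : ((N : ℝ) + 1) * recordProb (d + 1) N ≤ recordMean d (N + 2) := by
      rw [succ_mul_recordProb]
      exact recordMean_mono d (by omega)
    have hf := recordProb_nonneg (d + 1) N
    calc _ ≤ (2 * ((N : ℝ) + 1)) ^ 2 * (recordProb (d + 1) N / (N + 1)) := by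
          gcongr
          linarith [N.cast_nonneg (α := ℝ)]
      _ = 4 * (((N : ℝ) + 1) * recordProb (d + 1) N) := by field_simp; ring
      _ ≤ _ := by gcongr
  calc _ ≤ ∑ j ∈ Finset.range (N + 2), ∑ k ∈ Finset.Ico (j + 1) (N + 2), B := by
        refine Finset.sum_le_sum fun j hj => Finset.sum_le_sum fun k hk => ?_
        rw [Finset.mem_range] at hj
        rw [Finset.mem_Ico] at hk
        exact h.currentPair_le (Nat.le_add_left 1 d) hj hk.2 (by omega)
    _ ≤ ∑ j ∈ Finset.range (N + 2), ((N : ℝ) + 2) * B := by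
        refine Finset.sum_le_sum fun j _ => ?_
        rw [Finset.sum_const, Nat.card_Ico, nsmul_eq_mul]
        gcongr
        have : N + 2 - (j + 1) ≤ N + 2 := by omega
        exact_mod_cast this
    _ = ((N : ℝ) + 2) ^ 2 * B := by
        simp
        ring
    _ = 2 * (((N : ℝ) + 2) ^ 2 * pairIntegral (d + 1) ((N - 1) - (N - 1) / 2)) +
          2 * (((N : ℝ) + 2) ^ 2 * (recordProb (d + 1) N / (N + 1))) := by
        simp only [B]
        ring
    _ ≤ _ := by linarith

theorem memLp_β (h : IsExpSample μ X) (n : ℕ) : MemLp (β X n) 2 μ := by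
  rw [β_eq_sub]
  exact (h.memLp_R n).sub (h.memLp_r n)

theorem integral_β (h : IsExpSample μ X) (n : ℕ) :
    ∫ ω, β X n ω ∂μ = recordMean (d + 1) n - recordMean d n := by
  rw [β_eq_sub, ← h.integral_R, ← h.integral_r]
  exact integral_sub ((h.memLp_R n).integrable one_le_two) ((h.memLp_r n).integrable one_le_two)

/-- The parallelogram identity bounds Var(R - r) by 2 Var R + 2 Var r. Both are O(1 + E R), which is
O(1 + E β) by `exists_recordMean_le_half`. -/
theorem exists_variance_β_le (h : IsExpSample μ X) :
    ∃ C : ℝ, ∀ n, variance (β X n) μ ≤ C * (1 + ∫ ω, β X n ω ∂μ) := by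
  obtain ⟨C₀, hC₀⟩ := exists_recordMean_le_half d
  set A : ℝ := 3 + 32 * 4 ^ (d + 1)
  set B : ℝ := 17 + 400 * 4 ^ (d + 1)
  have hA : 0 ≤ A := by positivity
  have hB : 0 ≤ B := by positivity
  refine ⟨(2 * A + 2 * B) * (2 + 4 * |C₀|), fun n => ?_⟩
  have hsum : variance (β X n) μ ≤ 2 * variance (R X n) μ + 2 * variance (r X n) μ := by
    have h1 := variance_sub (h.memLp_R n) (h.memLp_r n)
    have h2 := variance_add (h.memLp_R n) (h.memLp_r n)
    have h3 := variance_nonneg (R X n + r X n) μ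
    rw [β_eq_sub]
    linarith
  have hR := h.variance_R_le n
  have hr := h.variance_r_le n
  rw [h.integral_β]
  have h0 := hC₀ n
  have hd0 := recordMean_nonneg d n
  have hd1 := recordMean_nonneg (d + 1) n
  have hle : recordMean d n ≤ recordMean (d + 1) n + 2 * |C₀| := by
    linarith [le_abs_self C₀, abs_nonneg C₀]
  have hβ : 0 ≤ recordMean (d + 1) n - recordMean d n := by
    rw [← h.integral_β]
    exact integral_nonneg fun ω => Nat.cast_nonneg _
  have hle2 : recordMean (d + 1) n + 2 * |C₀| ≤
      (2 + 4 * |C₀|) * (1 + (recordMean (d + 1) n - recordMean d n)) := by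
    nlinarith [le_abs_self C₀, mul_nonneg (abs_nonneg C₀) hβ]
  calc variance (β X n) μ ≤ 2 * (A * recordMean (d + 1) n) + 2 * (B * recordMean d n) := by
        linarith
    _ ≤ 2 * (A * (recordMean (d + 1) n + 2 * |C₀|)) +
          2 * (B * (recordMean (d + 1) n + 2 * |C₀|)) := by
        gcongr
        linarith [abs_nonneg C₀]
    _ = (2 * A + 2 * B) * (recordMean (d + 1) n + 2 * |C₀|) := by ring
    _ ≤ _ := by
        rw [mul_assoc]
        gcongr

end IsExpSample

/-- A broken record stays broken. Remaining records can disappear, so `currentCount` has no such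
monotonicity. -/
theorem brokenCount_mono {d : ℕ} (x : ℕ → Fin d → ℝ) : Monotone (brokenCount x) := by
  classical
  intro m n hmn
  refine Finset.card_le_card fun k hk => ?_
  simp only [Finset.mem_filter, Finset.mem_range] at hk ⊢
  obtain ⟨hk, hrec, l, h1, h2, h3⟩ := hk
  exact ⟨hk.trans_le hmn, hrec, l, h1, h2.trans_le hmn, h3⟩

theorem recordCount_mono {d : ℕ} (x : ℕ → Fin d → ℝ) : Monotone (recordCount x) := by
  classical
  intro m n hmn
  exact Finset.card_le_card (Finset.filter_subset_filter _ (Finset.range_mono hmn))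

end

/-! ### Borel–Cantelli for monotone counts and comparison with logarithms -/

section

theorem ae_eventually_abs_sub_integral_le {Ω : Type*} [MeasurableSpace Ω] {μ : Measure Ω}
    [IsProbabilityMeasure μ] {S : ℕ → Ω → ℝ} (hS : ∀ n, MemLp (S n) 2 μ)
    (hmono : ∀ ω, Monotone fun n => S n ω) (h0 : ∫ ω, S 0 ω ∂μ ≤ 1)
    (hstep : ∀ n, ∫ ω, S (n + 1) ω ∂μ ≤ ∫ ω, S n ω ∂μ + 1)
    (hlim : Tendsto (fun n => ∫ ω, S n ω ∂μ) atTop atTop) {C : ℝ}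
    (hvar : ∀ n, variance (S n) μ ≤ C * (1 + ∫ ω, S n ω ∂μ)) :
    ∀ᵐ ω ∂μ, ∀ᶠ n in atTop,
      |S n ω - ∫ ω', S n ω' ∂μ| ≤ 24 * (∫ ω', S n ω' ∂μ) ^ (3 / 4 : ℝ) := by
  set m : ℕ → ℝ := fun n => ∫ ω, S n ω ∂μ
  have hm : Monotone m := fun a b hab =>
    integral_mono ((hS a).integrable one_le_two) ((hS b).integrable one_le_two)
      fun ω => hmono ω hab
  have hex (k : ℕ) : ∃ n, (k : ℝ) ^ 4 ≤ m n := (hlim.eventually_ge_atTop _).exists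
  classical
  -- The first time the mean reaches k^4. Unit increments, and the bound on the initial mean, keep
  -- the overshoot at most 1.
  set N : ℕ → ℕ := fun k => Nat.find (hex k)
  have hN1 (k : ℕ) : (k : ℝ) ^ 4 ≤ m (N k) := Nat.find_spec (hex k)
  have hN2 (k : ℕ) : m (N k) ≤ (k : ℝ) ^ 4 + 1 := by
    rcases hNk : N k with _ | n
    · have : (0 : ℝ) ≤ (k : ℝ) ^ 4 := by positivity
      exact h0.trans (by linarith)
    · have h1 : m n < (k : ℝ) ^ 4 := not_le.1 (Nat.find_min (hex k) (m := n) (by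
        change n < N k
        omega))
      have h2 := hstep n
      change m (n + 1) ≤ m n + 1 at h2
      linarith
  have hbc : ∀ᵐ ω ∂μ, ∀ᶠ k : ℕ in atTop,
      ω ∉ {ω | ((k : ℝ) + 1) ^ 3 ≤ |S (N (k + 1)) ω - m (N (k + 1))|} := by
    refine ae_eventually_notMem ?_
    -- Chebyshev at level (k+1)^3 with variance at most 3|C|(k+1)^4 gives the summable order
    -- (k+1)^(-2). The index is shifted to avoid level 0.
    have hsum : Summable fun k : ℕ => 3 * |C| * (1 / ((k : ℝ) + 1) ^ 2) := by
      have := (summable_nat_add_iff 1).2 (Real.summable_one_div_nat_pow.2 one_lt_two)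
      exact_mod_cast this.mul_left (3 * |C|)
    refine ne_top_of_le_ne_top hsum.tsum_ofReal_ne_top (ENNReal.tsum_le_tsum fun k => ?_)
    refine (meas_ge_le_variance_div_sq (hS _) (by positivity)).trans (ENNReal.ofReal_le_ofReal ?_)
    have hk : (1 : ℝ) ≤ ((k : ℝ) + 1) ^ 4 := one_le_pow₀ (by linarith [k.cast_nonneg (α := ℝ)])
    have h2 := hN2 (k + 1)
    have h1 := hN1 (k + 1)
    push_cast at h1 h2
    have hv : variance (S (N (k + 1))) μ ≤ 3 * |C| * ((k : ℝ) + 1) ^ 4 := by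
      calc variance (S (N (k + 1))) μ ≤ C * (1 + m (N (k + 1))) := hvar _
        _ ≤ |C| * (3 * ((k : ℝ) + 1) ^ 4) := by
            gcongr
            · linarith
            · exact le_abs_self C
            · linarith
        _ = _ := by ring
    rw [div_le_iff₀ (by positivity)]
    refine hv.trans (le_of_eq ?_)
    field_simp
  filter_upwards [hbc] with ω hω
  obtain ⟨K, hK⟩ := eventually_atTop.1 hω
  filter_upwards [hlim.eventually_ge_atTop (((K : ℝ) + 1) ^ 4)] with n hn
  change |S n ω - m n| ≤ 24 * m n ^ (3 / 4 : ℝ)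
  change ((K : ℝ) + 1) ^ 4 ≤ m n at hn
  have hmn : 0 ≤ m n := le_trans (by positivity) hn
  set t := m n ^ (1 / 4 : ℝ)
  have ht0 : 0 ≤ t := Real.rpow_nonneg hmn _
  have ht4 : t ^ 4 = m n := by
    rw [← Real.rpow_natCast, ← Real.rpow_mul hmn]
    norm_num
  have ht3 : t ^ 3 = m n ^ (3 / 4 : ℝ) := by
    rw [← Real.rpow_natCast, ← Real.rpow_mul hmn]
    norm_num
  have hKt : (K : ℝ) + 1 ≤ t := by
    refine le_of_pow_le_pow_left₀ (n := 4) (by norm_num) ht0 ?_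
    rwa [ht4]
  -- With t the fourth root of the mean, κ^4 ≤ m n < (κ+1)^4, so n lies between `N κ` and `N (κ +
  -- 1)` and both counts there are controlled.
  set κ := ⌊t⌋₊
  have hκt : (κ : ℝ) ≤ t := Nat.floor_le ht0
  have htκ : t < κ + 1 := Nat.lt_floor_add_one t
  have hKκ : K + 1 ≤ κ := Nat.le_floor (by exact_mod_cast hKt)
  have hκ1 : (1 : ℝ) ≤ κ := by exact_mod_cast (Nat.le_add_left 1 K).trans hKκ
  have hlow : N κ ≤ n := Nat.find_le (by
    rw [← ht4]
    gcongr)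
  have hhigh : n ≤ N (κ + 1) := by
    by_contra! hlt
    have h1 := hN1 (κ + 1)
    have h2 := hm hlt.le
    have h3 : t ^ 4 < ((κ : ℝ) + 1) ^ 4 := by gcongr
    push_cast at h1
    linarith
  have hd1 : |S (N κ) ω - m (N κ)| < (κ : ℝ) ^ 3 := by
    have := hK (κ - 1) (by omega)
    simp only [not_le, Nat.sub_add_cancel ((Nat.le_add_left 1 K).trans hKκ)]
      at this
    rwa [Nat.cast_sub ((Nat.le_add_left 1 K).trans hKκ), Nat.cast_one, sub_add_cancel] at this
  have hd2 : |S (N (κ + 1)) ω - m (N (κ + 1))| < ((κ : ℝ) + 1) ^ 3 := by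
    simpa using hK κ (by omega)
  have h1 := hmono ω hlow
  have h2 := hmono ω hhigh
  have h3 := hm hlow
  have h4 := hm hhigh
  have h5 := hN1 κ
  have h6 := hN2 (κ + 1)
  push_cast at h6
  simp only at h1 h2
  rw [abs_lt] at hd1 hd2
  have hκ3 : (κ : ℝ) ^ 3 ≤ m n ^ (3 / 4 : ℝ) := by
    rw [← ht3]
    gcongr
  -- The left side expands to 5κ³ + 9κ² + 7κ + 3, and 5 + 9 + 7 + 3 = 24 with κ ≥ 1.
  have hp : ((κ : ℝ) + 1) ^ 3 + ((κ : ℝ) + 1) ^ 4 + 1 - (κ : ℝ) ^ 4 ≤ 24 * (κ : ℝ) ^ 3 := by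
    have e2 : (κ : ℝ) ^ 2 ≤ (κ : ℝ) ^ 3 := pow_le_pow_right₀ hκ1 (by norm_num)
    have e1 : (κ : ℝ) ≤ (κ : ℝ) ^ 3 := le_self_pow₀ hκ1 (by norm_num)
    have e0 : (1 : ℝ) ≤ (κ : ℝ) ^ 3 := one_le_pow₀ hκ1
    nlinarith
  have hp' : (κ : ℝ) ^ 3 ≤ ((κ : ℝ) + 1) ^ 3 := by gcongr; linarith
  rw [abs_le]
  constructor <;> linarith

theorem tendsto_div_one_of_abs_sub_le {Z z a : ℕ → ℝ} (h : ∀ᶠ n in atTop, |Z n - z n| ≤ a n)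
    (hz : ∀ᶠ n in atTop, 0 < z n) (ha : Tendsto (fun n => a n / z n) atTop (𝓝 0)) :
    Tendsto (fun n => Z n / z n) atTop (𝓝 1) := by
  rw [tendsto_iff_norm_sub_tendsto_zero]
  refine squeeze_zero' (Eventually.of_forall fun n => norm_nonneg _) ?_ ha
  filter_upwards [h, hz] with n hn hzn
  have : Z n / z n - 1 = (Z n - z n) / z n := by field_simp
  rw [this, Real.norm_eq_abs, abs_div, abs_of_pos hzn]
  gcongr

theorem tendsto_const_mul_rpow_div_self {m : ℕ → ℝ} (hm : Tendsto m atTop atTop) (c : ℝ) :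
    Tendsto (fun n => c * m n ^ (3 / 4 : ℝ) / m n) atTop (𝓝 0) := by
  have h := ((tendsto_rpow_neg_atTop (y := 1 / 4) (by norm_num)).comp hm).const_mul c
  rw [mul_zero] at h
  refine h.congr' ?_
  filter_upwards [hm.eventually_gt_atTop 0] with n hn
  have : m n ^ (-(1 / 4) : ℝ) = m n ^ (3 / 4 : ℝ) / m n := by
    rw [← Real.rpow_sub_one hn.ne']
    norm_num
  simp only [Function.comp_apply, this]
  ring

theorem tendsto_log_natCast : Tendsto (fun n : ℕ => Real.log n) atTop atTop :=
  Real.tendsto_log_atTop.comp tendsto_natCast_atTop_atTop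

theorem eventually_recordMean_rpow_le (d : ℕ) :
    ∀ᶠ n : ℕ in atTop, recordMean d n ^ (3 / 4 : ℝ) ≤
      2 ^ (3 * (d : ℝ) / 4) * Real.log n ^ (3 * (d : ℝ) / 4) := by
  filter_upwards [tendsto_log_natCast.eventually_ge_atTop 1, eventually_ge_atTop 1] with n hl hn
  obtain ⟨n, rfl⟩ := Nat.exists_eq_add_of_le' hn
  have h := recordMean_le d n
  push_cast at hl ⊢
  have h2 : recordMean d (n + 1) ≤ (2 * Real.log (n + 1)) ^ d :=
    h.trans (by gcongr; linarith)
  calc _ ≤ ((2 * Real.log (n + 1)) ^ d) ^ (3 / 4 : ℝ) :=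
        Real.rpow_le_rpow (recordMean_nonneg _ _) h2 (by norm_num)
    _ = (2 * Real.log (n + 1)) ^ (3 * (d : ℝ) / 4) := by
        rw [← Real.rpow_natCast, ← Real.rpow_mul (by positivity)]
        congr 1
        ring
    _ = _ := Real.mul_rpow (by norm_num) (by linarith)

theorem eventually_recordMean_rpow_lt (d : ℕ) (c : ℝ) {ε : ℝ} (hε : 0 < ε) :
    ∀ᶠ n : ℕ in atTop, c * recordMean d n ^ (3 / 4 : ℝ) < Real.log n ^ (3 * (d : ℝ) / 4 + ε) := by
  have h := ((tendsto_rpow_atTop hε).comp tendsto_log_natCast).eventually_gt_atTop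
    (|c| * 2 ^ (3 * (d : ℝ) / 4))
  filter_upwards [h, eventually_recordMean_rpow_le d,
    tendsto_log_natCast.eventually_gt_atTop 0] with n h1 h2 h3
  have h4 : 0 < Real.log n ^ (3 * (d : ℝ) / 4) := Real.rpow_pos_of_pos h3 _
  have h5 : 0 ≤ recordMean d n ^ (3 / 4 : ℝ) := Real.rpow_nonneg (recordMean_nonneg _ _) _
  rw [Real.rpow_add h3]
  calc c * recordMean d n ^ (3 / 4 : ℝ) ≤ |c| * recordMean d n ^ (3 / 4 : ℝ) := by
        gcongr
        exact le_abs_self c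
    _ ≤ |c| * (2 ^ (3 * (d : ℝ) / 4) * Real.log n ^ (3 * (d : ℝ) / 4)) := by gcongr
    _ = (|c| * 2 ^ (3 * (d : ℝ) / 4)) * Real.log n ^ (3 * (d : ℝ) / 4) := by ring
    _ < Real.log n ^ ε * Real.log n ^ (3 * (d : ℝ) / 4) := by
        gcongr
        exact h1
    _ = _ := mul_comm _ _

/-- Here the dimension is d + 1. The ratio has logarithmic exponent 3(d+1)/4 - d = (3-d)/4, which is
negative for d ≥ 4. -/
theorem tendsto_recordMean_rpow_div {d : ℕ} (hd : 4 ≤ d) (c : ℝ) :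
    Tendsto (fun n => c * recordMean (d + 1) n ^ (3 / 4 : ℝ) / recordMean d n) atTop (𝓝 0) := by
  have hd' : (4 : ℝ) ≤ d := by exact_mod_cast hd
  set e : ℝ := 3 * ((d + 1 : ℕ) : ℝ) / 4
  have hed : 0 < d - e := by
    simp only [e]
    push_cast
    linarith
  have h := ((tendsto_rpow_neg_atTop hed).comp tendsto_log_natCast).const_mul
    (|c| * 2 ^ e * d.factorial)
  rw [mul_zero] at h
  refine squeeze_zero_norm' ?_ h
  filter_upwards [eventually_recordMean_rpow_le (d + 1),
    tendsto_log_natCast.eventually_gt_atTop 0, eventually_ge_atTop 1] with n h2 h3 hn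
  have hf : (0 : ℝ) < d.factorial := by exact_mod_cast d.factorial_pos
  have hlow : Real.log n ^ d / d.factorial ≤ recordMean d n := by
    obtain ⟨n, rfl⟩ := Nat.exists_eq_add_of_le' hn
    refine le_trans ?_ (le_recordMean d n)
    gcongr
    push_cast
    linarith
  have hpos : 0 < Real.log n ^ d / d.factorial := by positivity
  have h5 : 0 ≤ recordMean (d + 1) n ^ (3 / 4 : ℝ) := Real.rpow_nonneg (recordMean_nonneg _ _) _
  rw [norm_div, norm_mul, Real.norm_eq_abs c, Real.norm_of_nonneg h5,
    Real.norm_of_nonneg (recordMean_nonneg _ _)]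
  calc |c| * recordMean (d + 1) n ^ (3 / 4 : ℝ) / recordMean d n
      ≤ |c| * (2 ^ e * Real.log n ^ e) / (Real.log n ^ d / d.factorial) := by
        gcongr
    _ = _ := by
        simp only [Function.comp_apply]
        rw [neg_sub, Real.rpow_sub h3, Real.rpow_natCast]
        field_simp

end

/-! ### Almost sure bounds for exponential samples -/

section

section Conclusion

variable {Ω : Type*} [MeasurableSpace Ω] {μ : Measure Ω} [IsProbabilityMeasure μ]

theorem IsExpSample.ae_eventually_R {d : ℕ} {X : ℕ → Ω → Fin (d + 1) → ℝ} (h : IsExpSample μ X) :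
    ∀ᵐ ω ∂μ, ∀ᶠ n in atTop, |R X n ω - ∫ ω', R X n ω' ∂μ| ≤
      24 * (∫ ω', R X n ω' ∂μ) ^ (3 / 4 : ℝ) := by
  refine ae_eventually_abs_sub_integral_le h.memLp_R
    (fun ω a b hab => Nat.cast_le.2 (recordCount_mono _ hab)) ?_ (fun n => ?_) ?_
    (C := 3 + 32 * 4 ^ (d + 1)) fun n => ?_
  · simp [h.integral_R, recordMean]
  · rw [h.integral_R, h.integral_R, recordMean, Finset.sum_range_succ]
    exact add_le_add_right (recordProb_le_one _ _) _
  · simp_rw [h.integral_R]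
    exact tendsto_recordMean_succ d
  · refine (h.variance_R_le n).trans ?_
    rw [h.integral_R]
    gcongr
    linarith

theorem IsExpSample.tendsto_integral_β {d : ℕ} {X : ℕ → Ω → Fin (d + 1) → ℝ}
    (h : IsExpSample μ X) : Tendsto (fun n => ∫ ω, β X n ω ∂μ) atTop atTop := by
  obtain ⟨C, hC⟩ := exists_recordMean_le_half d
  refine tendsto_atTop_mono (f := fun n => recordMean (d + 1) n / 2 + -C) (fun n => ?_)
    (tendsto_atTop_add_const_right _ _ ((tendsto_recordMean_succ d).atTop_div_const two_pos))
  rw [h.integral_β]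
  linarith [hC n]

theorem IsExpSample.ae_eventually_β {d : ℕ} {X : ℕ → Ω → Fin (d + 1) → ℝ} (h : IsExpSample μ X) :
    ∀ᵐ ω ∂μ, ∀ᶠ n in atTop, |β X n ω - ∫ ω', β X n ω' ∂μ| ≤
      24 * (∫ ω', β X n ω' ∂μ) ^ (3 / 4 : ℝ) := by
  obtain ⟨C, hC⟩ := h.exists_variance_β_le
  refine ae_eventually_abs_sub_integral_le h.memLp_β
    (fun ω a b hab => Nat.cast_le.2 (brokenCount_mono _ hab)) ?_ (fun n => ?_)
    h.tendsto_integral_β hC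
  · simp [h.integral_β, recordMean]
  · rw [h.integral_β, h.integral_β]
    have h1 := recordMean_mono d n.le_succ
    have h2 := recordProb_le_one (d + 1) n
    have h3 : recordMean (d + 1) (n + 1) = recordMean (d + 1) n + recordProb (d + 1) n :=
      Finset.sum_range_succ _ _
    linarith

end Conclusion

theorem measure_frequently_log_rpow_le_eq_zero {Ω : Type*} [MeasurableSpace Ω]
    {μ : Measure Ω} {d : ℕ} {Z : ℕ → Ω → ℝ} {z : ℕ → ℝ} {c : ℝ}
    (h : ∀ᵐ ω ∂μ, ∀ᶠ n in atTop, |Z n ω - z n| ≤ c * recordMean d n ^ (3 / 4 : ℝ)) {ε : ℝ}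
    (hε : 0 < ε) :
    μ {ω | ∃ᶠ n : ℕ in atTop, Real.log n ^ (3 * (d : ℝ) / 4 + ε) ≤ |Z n ω - z n|} = 0 := by
  have : ∀ᵐ ω ∂μ, ¬ ∃ᶠ n : ℕ in atTop,
      Real.log n ^ (3 * (d : ℝ) / 4 + ε) ≤ |Z n ω - z n| := by
    filter_upwards [h] with ω hω
    rw [not_frequently]
    filter_upwards [hω, eventually_recordMean_rpow_lt d c hε] with n h1 h2
    exact not_le.2 (h1.trans_lt h2)
  simpa only [ae_iff, not_not] using this

/-- Random vectors with the law `expLaw d` agree almost surely with measurable ones. -/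
theorem exists_isExpSample {Ω : Type*} [MeasurableSpace Ω] {μ : Measure Ω} {d : ℕ}
    {X : ℕ → Ω → Fin d → ℝ} (hindep : iIndepFun X μ)
    (hlaw : ∀ k, HasLaw (X k) (expLaw d) μ) :
    ∃ X' : ℕ → Ω → Fin d → ℝ, IsExpSample μ X' ∧
      ∀ᵐ ω ∂μ, (fun k => X k ω) = fun k => X' k ω := by
  have hae (k : ℕ) := (hlaw k).aemeasurable.ae_eq_mk
  refine ⟨fun k => (hlaw k).aemeasurable.mk, ⟨fun k => (hlaw k).aemeasurable.measurable_mk,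
    (iIndepFun_congr hae).1 hindep, fun k => ?_⟩, ?_⟩
  · rw [← Measure.map_congr (hae k), (hlaw k).map_eq]
  · filter_upwards [ae_all_iff.2 hae] with ω hω using funext hω

end

end ParetoRecords

theorem theoremT {Ω : Type*} [MeasurableSpace Ω] (μ : Measure Ω) [IsProbabilityMeasure μ]
    (d : ℕ) (hd : 1 ≤ d) (X : ℕ → Ω → Fin d → ℝ)
    (hindep : iIndepFun X μ)
    (hlaw : ∀ k, HasLaw (X k) (Measure.pi fun _ : Fin d => expMeasure 1) μ) :
    ((∀ ε : ℝ, 0 < ε →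
        μ {ω | ∃ᶠ n : ℕ in atTop,
          Real.log n ^ (3 * (d : ℝ) / 4 + ε) ≤
            |ParetoRecords.R X n ω - ∫ ω', ParetoRecords.R X n ω' ∂μ|} = 0) ∧
      ∀ᵐ ω ∂μ, Tendsto
        (fun n : ℕ => ParetoRecords.R X n ω / ∫ ω', ParetoRecords.R X n ω' ∂μ) atTop (𝓝 1)) ∧
    ((∀ ε : ℝ, 0 < ε →
        μ {ω | ∃ᶠ n : ℕ in atTop,
          Real.log n ^ (3 * (d : ℝ) / 4 + ε) ≤
            |ParetoRecords.β X n ω - ∫ ω', ParetoRecords.β X n ω' ∂μ|} = 0) ∧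
      ∀ᵐ ω ∂μ, Tendsto
        (fun n : ℕ => ParetoRecords.β X n ω / ∫ ω', ParetoRecords.β X n ω' ∂μ) atTop (𝓝 1)) ∧
    ((∀ ε : ℝ, 0 < ε →
        μ {ω | ∃ᶠ n : ℕ in atTop,
          Real.log n ^ (3 * (d : ℝ) / 4 + ε) ≤
            |ParetoRecords.r X n ω - ∫ ω', ParetoRecords.r X n ω' ∂μ|} = 0) ∧
      (5 ≤ d → ∀ᵐ ω ∂μ, Tendsto
        (fun n : ℕ => ParetoRecords.r X n ω / ∫ ω', ParetoRecords.r X n ω' ∂μ) atTop (𝓝 1))) := by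
  -- From here the dimension is d + 1, so that E r_n is `recordMean d n`.
  obtain ⟨d, rfl⟩ := Nat.exists_eq_add_of_le' hd
  obtain ⟨X', h, hae⟩ := ParetoRecords.exists_isExpSample hindep hlaw
  have haeR : ∀ᵐ ω ∂μ, ∀ n, ParetoRecords.R X n ω = ParetoRecords.R X' n ω := by
    filter_upwards [hae] with ω hω n
    simp only [ParetoRecords.R, hω]
  have haeβ : ∀ᵐ ω ∂μ, ∀ n, ParetoRecords.β X n ω = ParetoRecords.β X' n ω := by
    filter_upwards [hae] with ω hω n
    simp only [ParetoRecords.β, hω]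
  have haer : ∀ᵐ ω ∂μ, ∀ n, ParetoRecords.r X n ω = ParetoRecords.r X' n ω := by
    filter_upwards [hae] with ω hω n
    simp only [ParetoRecords.r, hω]
  have hER (n : ℕ) : ∫ ω, ParetoRecords.R X n ω ∂μ = ParetoRecords.recordMean (d + 1) n := by
    rw [← h.integral_R]
    exact integral_congr_ae (haeR.mono fun ω hω => hω n)
  have hEβ (n : ℕ) : ∫ ω, ParetoRecords.β X n ω ∂μ = ∫ ω, ParetoRecords.β X' n ω ∂μ :=
    integral_congr_ae (haeβ.mono fun ω hω => hω n)
  have hEr (n : ℕ) : ∫ ω, ParetoRecords.r X n ω ∂μ = ParetoRecords.recordMean d n := by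
    rw [← h.integral_r]
    exact integral_congr_ae (haer.mono fun ω hω => hω n)
  have hR : ∀ᵐ ω ∂μ, ∀ᶠ n in atTop, |ParetoRecords.R X n ω - ∫ ω', ParetoRecords.R X n ω' ∂μ| ≤
      24 * ParetoRecords.recordMean (d + 1) n ^ (3 / 4 : ℝ) := by
    filter_upwards [h.ae_eventually_R, haeR] with ω h1 h2
    filter_upwards [h1] with n hn
    rw [hER, h2]
    simpa only [h.integral_R] using hn
  have hβ : ∀ᵐ ω ∂μ, ∀ᶠ n in atTop, |ParetoRecords.β X n ω - ∫ ω', ParetoRecords.β X n ω' ∂μ| ≤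
      24 * (∫ ω', ParetoRecords.β X n ω' ∂μ) ^ (3 / 4 : ℝ) := by
    filter_upwards [h.ae_eventually_β, haeβ] with ω h1 h2
    filter_upwards [h1] with n hn
    rwa [hEβ, h2]
  have hβ' : ∀ᵐ ω ∂μ, ∀ᶠ n in atTop, |ParetoRecords.β X n ω - ∫ ω', ParetoRecords.β X n ω' ∂μ| ≤
      24 * ParetoRecords.recordMean (d + 1) n ^ (3 / 4 : ℝ) := by
    filter_upwards [hβ] with ω h1
    filter_upwards [h1] with n hn
    refine hn.trans ?_
    have h0 : 0 ≤ ∫ ω', ParetoRecords.β X n ω' ∂μ := integral_nonneg fun ω => Nat.cast_nonneg _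
    have h2 : ∫ ω', ParetoRecords.β X n ω' ∂μ ≤ ParetoRecords.recordMean (d + 1) n := by
      rw [hEβ, h.integral_β]
      linarith [ParetoRecords.recordMean_nonneg d n]
    gcongr
  -- Without monotonicity of r, the bounds for R and β are added, so the error has the scale of E
  -- R_n rather than of E r_n; 48 = 24 + 24.
  have hr : ∀ᵐ ω ∂μ, ∀ᶠ n in atTop, |ParetoRecords.r X n ω - ∫ ω', ParetoRecords.r X n ω' ∂μ| ≤
      48 * ParetoRecords.recordMean (d + 1) n ^ (3 / 4 : ℝ) := by
    filter_upwards [hR, hβ'] with ω h1 h2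
    filter_upwards [h1, h2] with n hn1 hn2
    have e1 := ParetoRecords.r_add_β hd X n ω
    have e2 : ∫ ω', ParetoRecords.r X n ω' ∂μ =
        ∫ ω', ParetoRecords.R X n ω' ∂μ - ∫ ω', ParetoRecords.β X n ω' ∂μ := by
      rw [hEr, hER, hEβ, h.integral_β]
      ring
    have e3 : ParetoRecords.r X n ω - ∫ ω', ParetoRecords.r X n ω' ∂μ =
        (ParetoRecords.R X n ω - ∫ ω', ParetoRecords.R X n ω' ∂μ) -
          (ParetoRecords.β X n ω - ∫ ω', ParetoRecords.β X n ω' ∂μ) := by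
      rw [e2, ← e1]
      ring
    rw [e3]
    exact (abs_sub _ _).trans (by linarith)
  have hlimR := ParetoRecords.tendsto_recordMean_succ d
  have hlimβ : Tendsto (fun n => ∫ ω, ParetoRecords.β X n ω ∂μ) atTop atTop := by
    simpa only [hEβ] using h.tendsto_integral_β
  refine ⟨⟨fun ε hε => ParetoRecords.measure_frequently_log_rpow_le_eq_zero hR hε, ?_⟩,
    ⟨fun ε hε => ParetoRecords.measure_frequently_log_rpow_le_eq_zero hβ' hε, ?_⟩,
    ⟨fun ε hε => ParetoRecords.measure_frequently_log_rpow_le_eq_zero hr hε, fun hd5 => ?_⟩⟩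
  · filter_upwards [hR] with ω hω
    refine ParetoRecords.tendsto_div_one_of_abs_sub_le hω ?_ ?_ <;> simp_rw [hER]
    · exact hlimR.eventually_gt_atTop 0
    · exact ParetoRecords.tendsto_const_mul_rpow_div_self hlimR 24
  · filter_upwards [hβ] with ω hω
    exact ParetoRecords.tendsto_div_one_of_abs_sub_le hω (hlimβ.eventually_gt_atTop 0)
      (ParetoRecords.tendsto_const_mul_rpow_div_self hlimβ 24)
  · obtain ⟨e, rfl⟩ : ∃ e, d = e + 1 := ⟨d - 1, by omega⟩
    filter_upwards [hr] with ω hω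
    refine ParetoRecords.tendsto_div_one_of_abs_sub_le hω ?_ ?_ <;> simp_rw [hEr]
    · exact (ParetoRecords.tendsto_recordMean_succ e).eventually_gt_atTop 0
    · exact ParetoRecords.tendsto_recordMean_rpow_div (by omega) 48
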